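/- Let $n\ge 1$ be an integer, $r$ an odd positive integer, and let $a_i,b_i>0$ be reals with $a_1<b_1<a_2<b_2<\dots<a_n<b_n$. Let $X_1,\dots,X_n,Y_1,\dots,Y_n$ be independent random variables, each chi-square distributed with $r$ degrees of freedom, and let $Z=\sum_{i=1}^n (a_iX_i+b_iY_i)$. Then $Z$ has a density $f_Z$ that vanishes on $(-\infty,0)$ and is continuous on $(0,\infty)$. For $x>0$ put \[ \bar y = x\max_{1\le i\le n}\frac{b_i-a_i}{4a_ib_i}. \] The computational complexity of calculating the value $f_Z(x)$, $x>0$, with relative error smaller than $R_{\max}\in(0,1)$ is \[ O\!\left(n^2r^2\max(1,\bar y)^2\,\bigl(1+\log (rn)-\log R_{\max}\bigr)\right). \] That is, there are a single program $P$ and an absolute constant $C>0$ such that for all $n,r,a_i,b_i,x,R_{\max}$ as above, $P$ with input $(n,r,(a_i),(b_i),x,R_{\max})$ halts with an output $v$ satisfying $|v-f_Z(x)|<R_{\max}\,f_Z(x)$ at cost at most $C\,n^2r^2\max(1,\bar y)^2(1+\log(rn)-\log R_{\max})$. Here cost is counted in the real-number (real RAM) model: programs use assignments, branching and while-loops over natural-number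 variables and arrays of real numbers, with natural-number constants only, and each arithmetic operation, each evaluation of $\sqrt{\cdot}$, $\exp$ or $\log$, each comparison, memory access and assignment on exact real numbers costs one unit. -/

import Mathlib

open MeasureTheory ProbabilityTheory

/-! ### The chi-square law and densities -/

/-- The chi-square law with `r` degrees of freedom: the law on `ℝ` with density
`x ^ (r / 2 - 1) * exp (- x / 2) / (2 ^ (r / 2) * Γ (r / 2))` on the positive half line,
that is, the gamma law with shape `r / 2` and rate `1 / 2`. -/
noncomputable def chiSq (r : ℕ) : Measure ℝ :=
  gammaMeasure ((r : ℝ) / 2) (1 / 2)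

/-- `f` is the density function of the law `ν` of a positive random variable, in its version that
vanishes on the negative half line and is continuous on the open positive half line. Continuity
determines the value of `f` at every point of the open positive half line. -/
structure IsPosDensity (f : ℝ → ℝ) (ν : Measure ℝ) : Prop where
  measurable : Measurable f
  nonneg : ∀ z, 0 ≤ f z
  eq_zero_of_neg : ∀ z, z < 0 → f z = 0
  continuousOn : ContinuousOn f (Set.Ioi 0)
  law_eq : ν = volume.withDensity (fun z => ENNReal.ofReal (f z))

/-- `ȳ = x * max_i (b_i - a_i) / (4 a_i b_i)`. -/
noncomputable def yBar {n : ℕ} (a b : Fin n → ℝ) (x : ℝ) : ℝ :=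
  x * ⨆ i, (b i - a i) / (4 * a i * b i)

/-! ### Real random access machines

Programs work on finitely many natural-number variables (used as counters and addresses) and on
finitely many arrays of exact real numbers. Every arithmetic operation, every evaluation of one of
the elementary functions `√`, `exp`, `log`, every comparison, every access to a variable or an array
cell and every assignment has unit cost. The only constants available to a program are natural
numbers. -/

namespace RealRAM

/-- The memory: natural-number variables, and real arrays (`real A k` is cell `k` of array `A`). -/
structure Store where
  nat : ℕ → ℕ
  real : ℕ → ℕ → ℝ

/-- Natural-number expressions. -/
inductive NExpr where
  | lit (k : ℕ)
  | var (v : ℕ)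
  | add (e₁ e₂ : NExpr)
  | sub (e₁ e₂ : NExpr)
  | mul (e₁ e₂ : NExpr)

/-- The value of a natural-number expression (`sub` is truncated subtraction). -/
def NExpr.eval (s : Store) : NExpr → ℕ
  | .lit k => k
  | .var v => s.nat v
  | .add e₁ e₂ => e₁.eval s + e₂.eval s
  | .sub e₁ e₂ => e₁.eval s - e₂.eval s
  | .mul e₁ e₂ => e₁.eval s * e₂.eval s

/-- The cost of evaluating a natural-number expression: its number of nodes. -/
def NExpr.cost : NExpr → ℕ
  | .lit _ => 1
  | .var _ => 1
  | .add e₁ e₂ => e₁.cost + e₂.cost + 1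
  | .sub e₁ e₂ => e₁.cost + e₂.cost + 1
  | .mul e₁ e₂ => e₁.cost + e₂.cost + 1

/-- Real expressions. `cell A e` reads cell `e` of the array `A`; `ofNat e` is the real number
given by the natural-number expression `e`. -/
inductive RExpr where
  | ofNat (e : NExpr)
  | cell (A : ℕ) (e : NExpr)
  | add (e₁ e₂ : RExpr)
  | sub (e₁ e₂ : RExpr)
  | mul (e₁ e₂ : RExpr)
  | div (e₁ e₂ : RExpr)
  | sqrt (e : RExpr)
  | exp (e : RExpr)
  | log (e : RExpr)

/-- The value of a real expression. Division, root and logarithm are exact on their natural domains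
and return Mathlib's default values outside; since programs may compare numbers with `0`, this gives
them no additional power. -/
noncomputable def RExpr.eval (s : Store) : RExpr → ℝ
  | .ofNat e => (e.eval s : ℝ)
  | .cell A e => s.real A (e.eval s)
  | .add e₁ e₂ => e₁.eval s + e₂.eval s
  | .sub e₁ e₂ => e₁.eval s - e₂.eval s
  | .mul e₁ e₂ => e₁.eval s * e₂.eval s
  | .div e₁ e₂ => e₁.eval s / e₂.eval s
  | .sqrt e => Real.sqrt (e.eval s)
  | .exp e => Real.exp (e.eval s)
  | .log e => Real.log (e.eval s)

/-- The cost of evaluating a real expression: its number of nodes. -/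
def RExpr.cost : RExpr → ℕ
  | .ofNat e => e.cost + 1
  | .cell _ e => e.cost + 1
  | .add e₁ e₂ => e₁.cost + e₂.cost + 1
  | .sub e₁ e₂ => e₁.cost + e₂.cost + 1
  | .mul e₁ e₂ => e₁.cost + e₂.cost + 1
  | .div e₁ e₂ => e₁.cost + e₂.cost + 1
  | .sqrt e => e.cost + 1
  | .exp e => e.cost + 1
  | .log e => e.cost + 1

/-- Tests: strict comparison of two natural numbers or of two real numbers. -/
inductive Test where
  | natLt (e₁ e₂ : NExpr)
  | realLt (e₁ e₂ : RExpr)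

/-- The truth value of a test. -/
def Test.Holds (s : Store) : Test → Prop
  | .natLt e₁ e₂ => e₁.eval s < e₂.eval s
  | .realLt e₁ e₂ => e₁.eval s < e₂.eval s

/-- The cost of a test. -/
def Test.cost : Test → ℕ
  | .natLt e₁ e₂ => e₁.cost + e₂.cost + 1
  | .realLt e₁ e₂ => e₁.cost + e₂.cost + 1

/-- Programs: assignments to a variable or to an array cell, sequencing, branching
(`ite t p q` runs `p` if `t` holds, `q` otherwise) and loops (`loop t p` runs `p` as long as `t`
holds). -/
inductive Prog where
  | skip
  | setNat (v : ℕ) (e : NExpr)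
  | setReal (A : ℕ) (k : NExpr) (e : RExpr)
  | seq (p q : Prog)
  | ite (t : Test) (p q : Prog)
  | loop (t : Test) (p : Prog)

/-- The store after the natural-number variable `v` has received the value `m`. -/
def Store.setNat (s : Store) (v m : ℕ) : Store where
  nat := Function.update s.nat v m
  real := s.real

/-- The store after cell `k` of the real array `A` has received the value `y`. -/
noncomputable def Store.setReal (s : Store) (A k : ℕ) (y : ℝ) : Store where
  nat := s.nat
  real := Function.update s.real A (Function.update (s.real A) k y)

/-- `Exec p s t s'`: the program `p`, started in the store `s`, halts at total cost `t` in the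
store `s'`. -/
inductive Exec : Prog → Store → ℕ → Store → Prop where
  | skip (s : Store) : Exec .skip s 1 s
  | setNat (s : Store) (v : ℕ) (e : NExpr) :
      Exec (.setNat v e) s (e.cost + 1) (s.setNat v (e.eval s))
  | setReal (s : Store) (A : ℕ) (k : NExpr) (e : RExpr) :
      Exec (.setReal A k e) s (k.cost + e.cost + 1) (s.setReal A (k.eval s) (e.eval s))
  | seq {p q : Prog} {s s' s'' : Store} {t₁ t₂ : ℕ} :
      Exec p s t₁ s' → Exec q s' t₂ s'' → Exec (.seq p q) s (t₁ + t₂) s''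
  | ite_true {c : Test} {p q : Prog} {s s' : Store} {t : ℕ} :
      c.Holds s → Exec p s t s' → Exec (.ite c p q) s (c.cost + t) s'
  | ite_false {c : Test} {p q : Prog} {s s' : Store} {t : ℕ} :
      ¬ c.Holds s → Exec q s t s' → Exec (.ite c p q) s (c.cost + t) s'
  | loop_true {c : Test} {p : Prog} {s s' s'' : Store} {t₁ t₂ : ℕ} :
      c.Holds s → Exec p s t₁ s' → Exec (.loop c p) s' t₂ s'' →
        Exec (.loop c p) s (c.cost + t₁ + t₂) s''
  | loop_false {c : Test} {p : Prog} {s : Store} :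
      ¬ c.Holds s → Exec (.loop c p) s c.cost s

/-- A finite sequence of reals as an array, the unused cells being `0`. -/
noncomputable def toArray {n : ℕ} (a : Fin n → ℝ) (k : ℕ) : ℝ :=
  if h : k < n then a ⟨k, h⟩ else 0

/-- The initial store: variables `0`, `1` hold `n`, `r`; arrays `0`, `1` hold the coefficients
`a`, `b`; cells `0`, `1` of array `2` hold the argument `x` and the precision `R`; all other
variables and cells are `0`. -/
noncomputable def inputStore {n : ℕ} (r : ℕ) (a b : Fin n → ℝ) (x R : ℝ) : Store where
  nat := fun v => if v = 0 then n else if v = 1 then r else 0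
  real := fun A k =>
    if A = 0 then toArray a k
    else if A = 1 then toArray b k
    else if A = 2 then (if k = 0 then x else if k = 1 then R else 0)
    else 0

/-- The output of a computation is read from cell `0` of array `3`. -/
def Store.output (s : Store) : ℝ := s.real 3 0

end RealRAM

/-! Write `Q = n r`. A chi-square law with `r` degrees of freedom is an `r`-fold convolution of the
law with one degree, so `f_Z` is a convolution of `Q` positive functions, each the density of `aX +
bY` with one degree of freedom. A beta integral gives that density in the form `w exp(-λt) I₀(δt)`,
where `λ = (1/a + 1/b)/4`, `δ = (1/a - 1/b)/4`, `w = 1/(2√(ab))` and `I₀(y)` is the mean of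
`exp(yx)` under the arcsine law (`conv_map_chiSq_one`, `map_sum_eq_halfDensity`).

The arcsine mean is replaced by the plain average over the `N = 2^p` roots of `T_N(z) = c`, with
`T_N` the Chebyshev polynomial. For every `c` in `(-1, 1)` this average is exact on polynomials of
degree below `N` (`nodeMean_pow`), so its error on `exp(yx)` is governed by a Taylor remainder. As
the arcsine mean of `exp(yx)` is at least `1`, the error is also relative, and relative errors of
nonnegative factors only compound under convolution (`abs_convChain_sub_le`). A relative error
`R/(4Q)` per factor suffices.

Each factor has now become a finite sum of exponentials with rates in `[1/(2b), 1/(2a)]`. If all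
rates are distinct, the convolution is again a sum of exponentials, and the coefficient at a pole is
the weight there times the Laplace transforms of the other factors (`convChain_expMixture`).
Distinctness uses the freedom in `c`: the `r` copies of a pair receive the levels `0, 1/r, …,
(r-1)/r`, while the ordering of the coefficients separates the intervals of different pairs
(`chebIter_ne_of_ordered`). Each Laplace transform is a logarithmic derivative of `T_N - c`
(`sum_inv_sub_node`), and since `N` is a power of two it takes only `O(p)` operations by iterating
`z ↦ 2z² - 1`.

There are `QN` poles and `Q` factors at each, whence a cost of order `Q² N p`. With `V` the larger
of `1` and `ȳ`, accuracy holds once `N² ≥ 729 V³` and `N p ≥ 5 log(8Q/R)`; the least such `p ≥ 1`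
has `N p = O(V² (1 + log Q - log R))` (`exists_levels`). The remaining work is a total-correctness
calculus for the machine, in which the program is verified together with its cost. -/

/-! ### Nodes of a Gauss–Chebyshev type rule, generated by iterated square roots -/

/-- The `p`-th iterate of `z ↦ 2 z ^ 2 - 1`, that is, the Chebyshev polynomial of degree `2 ^ p`. -/
noncomputable def chebIter (p : ℕ) (z : ℝ) : ℝ := (fun y : ℝ => 2 * y ^ 2 - 1)^[p] z

lemma chebIter_zero (z : ℝ) : chebIter 0 z = z := rfl

lemma chebIter_succ (p : ℕ) (z : ℝ) : chebIter (p + 1) z = chebIter p (2 * z ^ 2 - 1) := by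
  simp [chebIter, Function.iterate_succ_apply]

lemma chebIter_succ' (p : ℕ) (z : ℝ) : chebIter (p + 1) z = 2 * chebIter p z ^ 2 - 1 := by
  simp only [chebIter, Function.iterate_succ_apply']

lemma one_lt_abs_chebIter {z : ℝ} (hz : 1 < |z|) : ∀ p, 1 < |chebIter p z|
  | 0 => hz
  | p + 1 => by
    have h := (one_lt_sq_iff_one_lt_abs _).2 (one_lt_abs_chebIter hz p)
    rw [chebIter_succ', lt_abs]
    left; linarith

/-- Squaring removes the sign, so the iterate exceeds every level `c < 1` on both sides of `[-1,
1]`. This is what separates the poles of different pairs. -/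
lemma one_lt_chebIter_succ {z : ℝ} (hz : 1 < |z|) (p : ℕ) : 1 < chebIter (p + 1) z := by
  have h2 : 1 < chebIter p z ^ 2 := (one_lt_sq_iff_one_lt_abs _).2 (one_lt_abs_chebIter hz p)
  rw [chebIter_succ']; linarith

/-- The derivative of `chebIter p` at `z`, divided by `2 ^ p`. -/
noncomputable def chebDeriv (p : ℕ) (z : ℝ) : ℝ := ∏ i ∈ Finset.range p, 2 * chebIter i z

lemma chebDeriv_succ (p : ℕ) (z : ℝ) :
    chebDeriv (p + 1) z = 2 * z * chebDeriv p (2 * z ^ 2 - 1) := by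
  simp only [chebDeriv, Finset.prod_range_succ', chebIter_succ, chebIter_zero]
  ring

/-- The `2 ^ p` roots of `chebIter p z = c`. -/
noncomputable def node : ℕ → ℝ → ℕ → ℝ
  | 0, c, _ => c
  | p + 1, c, k =>
    if k < 2 ^ p then √((1 + node p c k) / 2) else -√((1 + node p c (k - 2 ^ p)) / 2)

lemma node_succ_of_lt {p k : ℕ} (c : ℝ) (hk : k < 2 ^ p) :
    node (p + 1) c k = √((1 + node p c k) / 2) := by
  simp [node, hk]

lemma node_succ_add (p k : ℕ) (c : ℝ) :
    node (p + 1) c (2 ^ p + k) = -√((1 + node p c k) / 2) := by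
  simp [node]

lemma sum_node_succ (p : ℕ) (c : ℝ) (g : ℝ → ℝ) :
    ∑ k ∈ Finset.range (2 ^ (p + 1)), g (node (p + 1) c k) =
      ∑ k ∈ Finset.range (2 ^ p),
        (g (√((1 + node p c k) / 2)) + g (-√((1 + node p c k) / 2))) := by
  rw [pow_succ, mul_two, Finset.sum_range_add, Finset.sum_add_distrib]
  congr 1
  · exact Finset.sum_congr rfl fun k hk => by rw [node_succ_of_lt c (Finset.mem_range.1 hk)]
  · exact Finset.sum_congr rfl fun k hk => by rw [node_succ_add]

lemma sqrt_half_lt_one {u : ℝ} (h1 : -1 < u) (h2 : u < 1) :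
    0 < √((1 + u) / 2) ∧ √((1 + u) / 2) < 1 ∧ √((1 + u) / 2) ^ 2 = (1 + u) / 2 := by
  refine ⟨Real.sqrt_pos.2 (by linarith), ?_, Real.sq_sqrt (by linarith)⟩
  rw [Real.sqrt_lt' one_pos]; linarith

lemma node_mem {c : ℝ} (h1 : -1 < c) (h2 : c < 1) : ∀ p k, -1 < node p c k ∧ node p c k < 1
  | 0, _ => ⟨h1, h2⟩
  | p + 1, k => by
    have key : ∀ j, _ := fun j => sqrt_half_lt_one (node_mem h1 h2 p j).1 (node_mem h1 h2 p j).2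
    rw [node]
    split_ifs
    · exact ⟨by linarith [(key k).1], (key k).2.1⟩
    · exact ⟨by linarith [(key (k - 2 ^ p)).2.1], by linarith [(key (k - 2 ^ p)).1]⟩

lemma chebIter_node {c : ℝ} (h1 : -1 < c) (h2 : c < 1) : ∀ p k, chebIter p (node p c k) = c
  | 0, _ => rfl
  | p + 1, k => by
    have key : ∀ j, _ := fun j => sqrt_half_lt_one (node_mem h1 h2 p j).1 (node_mem h1 h2 p j).2
    have h : ∃ j, 2 * node (p + 1) c k ^ 2 - 1 = node p c j := by
      rw [node]
      split_ifs
      · exact ⟨k, by rw [(key k).2.2]; ring⟩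
      · exact ⟨k - 2 ^ p, by rw [neg_sq, (key (k - 2 ^ p)).2.2]; ring⟩
    obtain ⟨j, hj⟩ := h
    rw [chebIter_succ, hj, chebIter_node h1 h2 p j]

/-- The logarithmic derivative of `T_N - c`, proved by pairing the roots `±w`: `1/(z - w) + 1/(z +
w) = 4z / ((2z² - 1) - (2w² - 1))`, which reduces level `p + 1` at `z` to level `p` at `2z² - 1`. It
makes a sum over `2^p` nodes computable in `O(p)` operations. -/
lemma sum_inv_sub_node {c : ℝ} (h1 : -1 < c) (h2 : c < 1) :
    ∀ (p : ℕ) (z : ℝ), chebIter p z ≠ c →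
      ∑ k ∈ Finset.range (2 ^ p), 1 / (z - node p c k) =
        2 ^ p * (chebDeriv p z / (chebIter p z - c))
  | 0, z, _ => by simp [chebDeriv, chebIter, node]
  | p + 1, z, hz => by
    rw [sum_node_succ p c (fun x => 1 / (z - x)), chebDeriv_succ, chebIter_succ]
    rw [chebIter_succ] at hz
    have ih := sum_inv_sub_node h1 h2 p _ hz
    calc _ = ∑ k ∈ Finset.range (2 ^ p), 4 * z * (1 / (2 * z ^ 2 - 1 - node p c k)) := by
          refine Finset.sum_congr rfl fun k _ => ?_
          obtain ⟨-, -, hw⟩ := sqrt_half_lt_one (node_mem h1 h2 p k).1 (node_mem h1 h2 p k).2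
          have hne : 2 * z ^ 2 - 1 - node p c k ≠ 0 := fun h0 => hz <| by
            rw [sub_eq_zero.1 h0, chebIter_node h1 h2]
          set w := √((1 + node p c k) / 2) with hwdef
          have hx : node p c k = 2 * w ^ 2 - 1 := by rw [hw]; ring
          rw [hx] at hne ⊢
          have hne' : (z - w) * (z + w) ≠ 0 := fun h0 => hne (by linear_combination 2 * h0)
          have ha := left_ne_zero_of_mul hne'
          have hb := right_ne_zero_of_mul hne'
          rw [sub_neg_eq_add]
          have : 2 * z ^ 2 - 1 - (2 * w ^ 2 - 1) = 2 * ((z - w) * (z + w)) := by ring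
          rw [this]
          field_simp
          ring
      _ = _ := by
          rw [← Finset.mul_sum, ih]
          ring

/-! ### The arcsine mean and the accuracy of the node averages -/

/-- The mean of `g` under the arcsine law on `(-1, 1)`. -/
noncomputable def arcMean (g : ℝ → ℝ) : ℝ := (1 / Real.pi) * ∫ θ in (0)..Real.pi, g (Real.cos θ)

/-- Doubling the angle preserves the uniform law on the circle, and `2cos²θ - 1 = cos 2θ`. -/
lemma arcMean_comp_double {g : ℝ → ℝ} (hg : Continuous g) :
    arcMean (fun x => g (2 * x ^ 2 - 1)) = arcMean g := by
  unfold arcMean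
  congr 1
  have h1 : ∫ θ in (0)..Real.pi, g (2 * Real.cos θ ^ 2 - 1)
      = ∫ θ in (0)..Real.pi, g (Real.cos (2 * θ)) := by
    simp only [Real.cos_two_mul]
  have hi : ∀ a b : ℝ, IntervalIntegrable (fun θ => g (Real.cos θ)) volume a b :=
    fun a b => (hg.comp Real.continuous_cos).intervalIntegrable _ _
  rw [h1, intervalIntegral.integral_comp_mul_left (fun θ => g (Real.cos θ)) two_ne_zero]
  rw [mul_zero, ← intervalIntegral.integral_add_adjacent_intervals (hi 0 Real.pi) (hi _ _)]
  have h2 : ∫ θ in Real.pi..(2 * Real.pi), g (Real.cos θ) = ∫ θ in (0)..Real.pi, g (Real.cos θ) := by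
    have := intervalIntegral.integral_comp_sub_left (a := 0) (b := Real.pi)
      (fun θ => g (Real.cos θ)) (2 * Real.pi)
    simp only [Real.cos_two_pi_sub, sub_zero] at this
    rw [this]; congr 1; ring
  rw [h2, smul_eq_mul]; ring

lemma arcMean_comp_neg (g : ℝ → ℝ) : arcMean (fun x => g (-x)) = arcMean g := by
  unfold arcMean
  congr 1
  have := intervalIntegral.integral_comp_sub_left (a := 0) (b := Real.pi)
      (fun θ => g (Real.cos θ)) Real.pi
  simpa [Real.cos_pi_sub] using this

lemma arcMean_sum {ι : Type*} (s : Finset ι) (g : ι → ℝ → ℝ) (hg : ∀ i ∈ s, Continuous (g i)) :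
    arcMean (fun x => ∑ i ∈ s, g i x) = ∑ i ∈ s, arcMean (g i) := by
  unfold arcMean
  rw [intervalIntegral.integral_finsetSum, Finset.mul_sum]
  exact fun i hi => ((hg i hi).comp Real.continuous_cos).intervalIntegrable _ _

lemma arcMean_const_mul (a : ℝ) (g : ℝ → ℝ) : arcMean (fun x => a * g x) = a * arcMean g := by
  unfold arcMean
  rw [intervalIntegral.integral_const_mul]; ring

lemma arcMean_const (a : ℝ) : arcMean (fun _ => a) = a := by
  unfold arcMean
  rw [intervalIntegral.integral_const, sub_zero, smul_eq_mul, ← mul_assoc,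
    one_div_mul_cancel Real.pi_ne_zero, one_mul]

lemma arcMean_mono {g h : ℝ → ℝ} (hg : Continuous g) (hh : Continuous h)
    (hle : ∀ x, |x| ≤ 1 → g x ≤ h x) : arcMean g ≤ arcMean h := by
  unfold arcMean
  refine mul_le_mul_of_nonneg_left ?_ (by positivity)
  refine intervalIntegral.integral_mono_on Real.pi_pos.le
    ((hg.comp Real.continuous_cos).intervalIntegrable _ _)
    ((hh.comp Real.continuous_cos).intervalIntegrable _ _) fun θ _ => ?_
  exact hle _ (Real.abs_cos_le_one θ)

lemma arcMean_add_const {f : ℝ → ℝ} (hf : Continuous f) (a : ℝ) :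
    arcMean (fun x => f x + a) = arcMean f + a := by
  have := arcMean_sum Finset.univ (fun i : Bool => if i then f else fun _ => a)
    (by rintro (_ | _) _ <;> simp [hf, continuous_const])
  simpa [arcMean_const] using this

/-- The mean over the nodes of level `p`. -/
noncomputable def nodeMean (p : ℕ) (c : ℝ) (g : ℝ → ℝ) : ℝ :=
  (∑ k ∈ Finset.range (2 ^ p), g (node p c k)) / 2 ^ p

lemma nodeMean_const_mul (p : ℕ) (c a : ℝ) (g : ℝ → ℝ) :
    nodeMean p c (fun x => a * g x) = a * nodeMean p c g := by
  unfold nodeMean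
  rw [← Finset.mul_sum]; ring

lemma nodeMean_sum {ι : Type*} (p : ℕ) (c : ℝ) (s : Finset ι) (g : ι → ℝ → ℝ) :
    nodeMean p c (fun x => ∑ i ∈ s, g i x) = ∑ i ∈ s, nodeMean p c (g i) := by
  unfold nodeMean
  rw [Finset.sum_comm, Finset.sum_div]

lemma nodeMean_const (p : ℕ) (c a : ℝ) : nodeMean p c (fun _ => a) = a := by
  simp [nodeMean]

lemma nodeMean_mono {p : ℕ} {c : ℝ} (h1 : -1 < c) (h2 : c < 1) {g h : ℝ → ℝ}
    (hle : ∀ x, |x| ≤ 1 → g x ≤ h x) : nodeMean p c g ≤ nodeMean p c h := by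
  unfold nodeMean
  gcongr with k
  exact hle _ (abs_le.2 ⟨(node_mem h1 h2 p k).1.le, (node_mem h1 h2 p k).2.le⟩)

/-- Node averages and the arcsine mean obey the same recursion under `z ↦ 2z² - 1`. Odd powers
vanish by symmetry; an even power `x^(2j)` is `((1 + u)/2)^j` with `u = 2x² - 1`, a polynomial of
half the degree, handled at the previous level. The level `c` plays no role. -/
lemma nodeMean_pow {c : ℝ} (h1 : -1 < c) (h2 : c < 1) :
    ∀ (p l : ℕ), l < 2 ^ p → nodeMean p c (fun x => x ^ l) = arcMean (fun x => x ^ l)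
  | 0, l, hl => by
    have : l = 0 := by simpa using hl
    subst this
    simp only [pow_zero]
    rw [nodeMean_const, arcMean_const]
  | p + 1, l, hl => by
    have step : ∀ g : ℝ → ℝ, nodeMean (p + 1) c g = (∑ k ∈ Finset.range (2 ^ p),
        (g (√((1 + node p c k) / 2)) + g (-√((1 + node p c k) / 2)))) / 2 ^ (p + 1) := by
      intro g; rw [nodeMean, sum_node_succ]
    rcases Nat.even_or_odd' l with ⟨j, rfl | rfl⟩
    · have hj : j < 2 ^ p := by rw [pow_succ] at hl; omega
      have expand : ∀ x : ℝ, ((1 + x) / 2) ^ j =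
          ∑ i ∈ Finset.range (j + 1), ((j.choose i : ℝ) / 2 ^ j) * x ^ i := by
        intro x
        rw [div_pow, add_comm, add_pow, Finset.sum_div]
        exact Finset.sum_congr rfl fun i _ => by rw [one_pow]; ring
      have hA : nodeMean (p + 1) c (fun x => x ^ (2 * j)) =
          nodeMean p c (fun x => ((1 + x) / 2) ^ j) := by
        rw [step, nodeMean, pow_succ, ← div_div]
        rw [div_right_comm, Finset.sum_div]
        congr 1
        refine Finset.sum_congr rfl fun k _ => ?_
        obtain ⟨-, -, hw⟩ := sqrt_half_lt_one (node_mem h1 h2 p k).1 (node_mem h1 h2 p k).2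
        rw [pow_mul, pow_mul, neg_sq, hw]; ring
      have hB : arcMean (fun x => x ^ (2 * j)) = arcMean (fun x => ((1 + x) / 2) ^ j) := by
        rw [← arcMean_comp_double (g := fun x => ((1 + x) / 2) ^ j) (by fun_prop)]
        congr 1; ext x; rw [pow_mul]; congr 1; ring
      rw [hA, hB]
      simp only [expand]
      rw [nodeMean_sum, arcMean_sum _ _ (fun i _ => by fun_prop)]
      refine Finset.sum_congr rfl fun i hi => ?_
      rw [nodeMean_const_mul, arcMean_const_mul, nodeMean_pow h1 h2 p i]
      have := Finset.mem_range.1 hi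
      omega
    · have hodd : ∀ x : ℝ, (-x) ^ (2 * j + 1) = -1 * x ^ (2 * j + 1) := fun x => by
        rw [Odd.neg_pow ⟨j, rfl⟩]; ring
      have hA : nodeMean (p + 1) c (fun x => x ^ (2 * j + 1)) = 0 := by
        rw [step]
        simp [hodd]
      have hB := arcMean_comp_neg (fun x => x ^ (2 * j + 1))
      simp only [hodd] at hB
      rw [arcMean_const_mul] at hB
      rw [hA]; linarith

lemma abs_exp_sub_taylor_le {u y : ℝ} (hu : |u| ≤ y) (n : ℕ) :
    |Real.exp u - ∑ m ∈ Finset.range n, u ^ m / m.factorial| ≤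
      y ^ n / n.factorial * Real.exp y := by
  have hy : 0 ≤ y := (abs_nonneg u).trans hu
  have hs : ∀ v : ℝ, Summable fun m : ℕ => v ^ m / (m.factorial : ℝ) :=
    Real.summable_pow_div_factorial
  have he : ∀ v : ℝ, Real.exp v = ∑' m : ℕ, v ^ m / (m.factorial : ℝ) := fun v => by
    rw [Real.exp_eq_exp_ℝ, NormedSpace.exp_eq_tsum_div]
  have htail : Real.exp u - ∑ m ∈ Finset.range n, u ^ m / m.factorial
      = ∑' m : ℕ, u ^ (m + n) / ((m + n).factorial : ℝ) := by
    rw [he, ← (hs u).sum_add_tsum_nat_add n]; ring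
  rw [htail, he y, ← tsum_mul_left, ← Real.norm_eq_abs]
  refine tsum_of_norm_bounded ((hs y).mul_left _).hasSum fun m => ?_
  rw [Real.norm_eq_abs, abs_div, abs_pow, Nat.abs_cast]
  -- The bound `n! m! ≤ (m + n)!` lets the tail of the series split off `y^n / n!` and leave a full
  -- exponential series.
  have hfac : ((n.factorial : ℝ) * m.factorial) ≤ (m + n).factorial := by
    have := Nat.le_of_dvd (Nat.factorial_pos _) (Nat.factorial_mul_factorial_dvd_factorial_add m n)
    rw [mul_comm]
    exact_mod_cast this
  calc |u| ^ (m + n) / ((m + n).factorial : ℝ) ≤ y ^ (m + n) / (n.factorial * m.factorial) := by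
        gcongr
    _ = _ := by rw [pow_add]; field_simp

/-- Both means are monotone, fix constants and agree on the Taylor polynomial of degree below `2^p`;
each therefore differs from that common value by at most the remainder, which explains the factor
`2`. -/
lemma abs_nodeMean_exp_sub_arcMean_le {c y : ℝ} (h1 : -1 < c) (h2 : c < 1) (hy : 0 ≤ y) (p : ℕ) :
    |nodeMean p c (fun x => Real.exp (y * x)) - arcMean (fun x => Real.exp (y * x))| ≤
      2 * (y ^ (2 ^ p) / (2 ^ p).factorial * Real.exp y) := by
  set N := 2 ^ p
  set B := y ^ N / N.factorial * Real.exp y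
  set S : ℝ → ℝ := fun x => ∑ m ∈ Finset.range N, y ^ m / m.factorial * x ^ m
  have hS : Continuous S := by fun_prop
  have hb : ∀ x, |x| ≤ 1 → |Real.exp (y * x) - S x| ≤ B := by
    intro x hx
    have hyx : |y * x| ≤ y := by
      rw [abs_mul, abs_of_nonneg hy]; exact mul_le_of_le_one_right hy hx
    have := abs_exp_sub_taylor_le hyx N
    convert this using 4 with m
    rw [mul_pow]; ring
  have hSeq : nodeMean p c S = arcMean S := by
    rw [nodeMean_sum, arcMean_sum _ _ (fun i _ => by fun_prop)]
    refine Finset.sum_congr rfl fun m hm => ?_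
    rw [nodeMean_const_mul, arcMean_const_mul, nodeMean_pow h1 h2 p m (Finset.mem_range.1 hm)]
  have addn : ∀ a : ℝ, ∀ f : ℝ → ℝ, nodeMean p c (fun x => f x + a) = nodeMean p c f + a := by
    intro a f
    simp [nodeMean, Finset.sum_add_distrib, add_div]
  have hE : Continuous fun x : ℝ => Real.exp (y * x) := by fun_prop
  have u1 := arcMean_mono (g := fun x => Real.exp (y * x)) (h := fun x => S x + B) hE (by fun_prop)
    fun x hx => by linarith [(abs_le.1 (hb x hx)).2]
  have u2 := arcMean_mono (g := fun x => S x + -B) (h := fun x => Real.exp (y * x)) (by fun_prop) hE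
    fun x hx => by linarith [(abs_le.1 (hb x hx)).1]
  have u3 := nodeMean_mono (p := p) h1 h2 (g := fun x => Real.exp (y * x)) (h := fun x => S x + B)
    fun x hx => by linarith [(abs_le.1 (hb x hx)).2]
  have u4 := nodeMean_mono (p := p) h1 h2 (g := fun x => S x + -B) (h := fun x => Real.exp (y * x))
    fun x hx => by linarith [(abs_le.1 (hb x hx)).1]
  rw [arcMean_add_const hS] at u1 u2
  rw [addn] at u3 u4
  rw [abs_le]
  constructor <;> linarith

/-- Jensen's inequality for a centred law. This lower bound turns absolute quadrature errors into
relative ones. -/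
lemma one_le_arcMean_exp (y : ℝ) : 1 ≤ arcMean (fun x => Real.exp (y * x)) := by
  have h := arcMean_mono (g := fun x => 1 + y * x) (h := fun x => Real.exp (y * x))
    (by fun_prop) (by fun_prop) fun x _ => by linarith [Real.add_one_le_exp (y * x)]
  have h0 : arcMean (fun x => 1 + y * x) = 1 := by
    unfold arcMean
    rw [intervalIntegral.integral_add (by simp)
      ((by fun_prop : Continuous fun θ => y * Real.cos θ).intervalIntegrable _ _)]
    simp [Real.pi_ne_zero]
  linarith

lemma continuous_arcMean_exp : Continuous fun y => arcMean (fun x => Real.exp (y * x)) := by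
  unfold arcMean
  refine continuous_const.mul ?_
  exact intervalIntegral.continuous_parametric_intervalIntegral_of_continuous'
    (by fun_prop) 0 Real.pi

/-- The accuracy that a level `p` with `729 M ^ 3 ≤ N ^ 2` and `8 ≤ ε ^ 3 N ^ N`, where `N = 2 ^ p`,
guarantees for arguments up to `M`. -/
lemma two_mul_pow_div_factorial_mul_exp_le {y M ε : ℝ} (hy : 0 ≤ y) (hyM : y ≤ M) (hM : 1 ≤ M)
    (hε : 0 < ε) {N : ℕ} (hN : 0 < N) (h1 : 729 * M ^ 3 ≤ (N : ℝ) ^ 2)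
    (h2 : 8 ≤ ε ^ 3 * (N : ℝ) ^ N) :
    2 * (y ^ N / N.factorial * Real.exp y) ≤ ε := by
  have hNr : (0 : ℝ) < N := by exact_mod_cast hN
  have hMN : M ≤ N := by
    nlinarith [mul_nonneg (sub_nonneg.2 hM) (sub_nonneg.2 hM), sq_nonneg (M - 1), pow_pos (by linarith : 0 < M) 3]
  have hfac : (N : ℝ) ^ N ≤ N.factorial * Real.exp N := by
    have := Real.pow_div_factorial_le_exp (N : ℝ) hNr.le N
    rwa [div_le_iff₀ (by positivity), mul_comm] at this
  have hexp : Real.exp 1 ^ 6 ≤ 729 := by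
    have : Real.exp 1 ≤ 3 := by linarith [Real.exp_one_lt_d9]
    calc Real.exp 1 ^ 6 ≤ 3 ^ 6 := by gcongr
      _ = 729 := by norm_num
  -- By `N^N ≤ N! e^N` and `y ≤ M ≤ N`, the remainder is at most `(M e²/N)^N`. Its cube times `N^N`
  -- is at most `(M³ e⁶/N²)^N`, and `e⁶ ≤ 3⁶ = 729` makes the base at most `1`.
  have key : (y ^ N / N.factorial * Real.exp y) ^ 3 * (N : ℝ) ^ N ≤ 1 := by
    have a1 : y ^ N / N.factorial * Real.exp y ≤ M ^ N * Real.exp N ^ 2 / (N : ℝ) ^ N := by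
      rw [le_div_iff₀ (by positivity)]
      calc y ^ N / N.factorial * Real.exp y * (N : ℝ) ^ N
          ≤ M ^ N / N.factorial * Real.exp N * (N.factorial * Real.exp N) := by
            gcongr; linarith
        _ = _ := by field_simp
    have a2 : (M ^ N * Real.exp N ^ 2 / (N : ℝ) ^ N) ^ 3 * (N : ℝ) ^ N
        = (M ^ 3 * Real.exp 1 ^ 6 / N ^ 2) ^ N := by
      have : Real.exp (N : ℝ) = Real.exp 1 ^ N := by rw [← Real.exp_nat_mul, mul_one]
      rw [this]
      simp only [div_pow, mul_pow, ← pow_mul]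
      field_simp
      ring
    have a3 : M ^ 3 * Real.exp 1 ^ 6 / N ^ 2 ≤ 1 := by
      rw [div_le_one (by positivity)]
      calc M ^ 3 * Real.exp 1 ^ 6 ≤ M ^ 3 * 729 := by gcongr
        _ ≤ _ := by linarith
    calc _ ≤ (M ^ N * Real.exp N ^ 2 / (N : ℝ) ^ N) ^ 3 * (N : ℝ) ^ N := by gcongr
      _ = _ := a2
      _ ≤ 1 := pow_le_one₀ (by positivity) a3
  have hpos : 0 < (N : ℝ) ^ N := by positivity
  refine le_of_pow_le_pow_left₀ three_ne_zero hε.le ?_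
  rw [mul_pow]
  nlinarith

/-! ### Iterated convolutions on the half line -/

/-- The convolution on the positive half line. -/
noncomputable def halfConv (F G : ℝ → ℝ) (t : ℝ) : ℝ := ∫ u in (0)..t, F u * G (t - u)

/-- The iterated convolution `g 0 * g 1 * ⋯ * g m`. -/
noncomputable def convChain (g : ℕ → ℝ → ℝ) : ℕ → ℝ → ℝ
  | 0 => g 0
  | m + 1 => halfConv (convChain g m) (g (m + 1))

lemma continuous_halfConv {F G : ℝ → ℝ} (hF : Continuous F) (hG : Continuous G) :
    Continuous (halfConv F G) := by
  unfold halfConv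
  exact intervalIntegral.continuous_parametric_intervalIntegral_of_continuous
    (f := fun t u => F u * G (t - u)) (by fun_prop) continuous_id

lemma continuous_convChain {g : ℕ → ℝ → ℝ} (hg : ∀ q, Continuous (g q)) :
    ∀ m, Continuous (convChain g m)
  | 0 => hg 0
  | m + 1 => continuous_halfConv (continuous_convChain hg m) (hg _)

lemma convChain_pos {g : ℕ → ℝ → ℝ} (hg : ∀ q, Continuous (g q))
    (hpos : ∀ q t, 0 ≤ t → 0 < g q t) : ∀ m t, 0 < t → 0 < convChain g m t
  | 0, t, ht => hpos 0 t ht.le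
  | m + 1, t, ht => by
    refine intervalIntegral.intervalIntegral_pos_of_pos_on ?_ (fun u hu => ?_) ht
    · exact ((continuous_convChain hg m).mul ((hg _).comp (by fun_prop))).intervalIntegrable _ _
    · exact mul_pos (convChain_pos hg hpos m u hu.1) (hpos _ _ (by linarith [hu.2]))

lemma convChain_nonneg {g : ℕ → ℝ → ℝ} (hpos : ∀ q t, 0 ≤ t → 0 ≤ g q t) :
    ∀ m t, 0 ≤ t → 0 ≤ convChain g m t
  | 0, t, ht => hpos 0 t ht
  | m + 1, t, ht => by
    refine intervalIntegral.integral_nonneg ht fun u hu => ?_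
    exact mul_nonneg (convChain_nonneg hpos m u hu.1) (hpos _ _ (by linarith [hu.2]))

/-- Relative bounds for the factors propagate to the convolution. -/
lemma convChain_le_mul {g h : ℕ → ℝ → ℝ} (hg : ∀ q, Continuous (g q)) (hh : ∀ q, Continuous (h q))
    {x α : ℝ} (hα : 0 ≤ α) {m : ℕ} (hg0 : ∀ q ≤ m, ∀ t, 0 ≤ t → t ≤ x → 0 ≤ g q t)
    (hle : ∀ q ≤ m, ∀ t, 0 ≤ t → t ≤ x → 0 ≤ h q t)
    (hgh : ∀ q ≤ m, ∀ t, 0 ≤ t → t ≤ x → g q t ≤ α * h q t) {t : ℝ} (ht : 0 ≤ t) (htx : t ≤ x) :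
    0 ≤ convChain g m t ∧ 0 ≤ convChain h m t ∧
      convChain g m t ≤ α ^ (m + 1) * convChain h m t := by
  induction m generalizing t with
  | zero =>
    exact ⟨hg0 0 le_rfl t ht htx, hle 0 le_rfl t ht htx, by simpa using! hgh 0 le_rfl t ht htx⟩
  | succ m ih =>
    have ih' : ∀ u ∈ Set.Icc 0 t, _ := fun u (hu : u ∈ Set.Icc 0 t) =>
      ih (fun q hq => hg0 q (by omega)) (fun q hq => hle q (by omega))
        (fun q hq => hgh q (by omega)) hu.1 (hu.2.trans htx)
    have hb : ∀ u ∈ Set.Icc 0 t, 0 ≤ t - u ∧ t - u ≤ x := fun u hu =>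
      ⟨by linarith [hu.2], by linarith [hu.1]⟩
    refine ⟨?_, ?_, ?_⟩
    · refine intervalIntegral.integral_nonneg ht fun u hu => ?_
      exact mul_nonneg (ih' u hu).1 (hg0 _ le_rfl _ (hb u hu).1 (hb u hu).2)
    · refine intervalIntegral.integral_nonneg ht fun u hu => ?_
      exact mul_nonneg (ih' u hu).2.1 (hle _ le_rfl _ (hb u hu).1 (hb u hu).2)
    · simp only [convChain, halfConv]
      rw [← intervalIntegral.integral_const_mul]
      refine intervalIntegral.integral_mono_on ht ?_ ?_ fun u hu => ?_
      · exact ((continuous_convChain hg m).mul ((hg _).comp (by fun_prop))).intervalIntegrable _ _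
      · exact (continuous_const.mul ((continuous_convChain hh m).mul
          ((hh _).comp (by fun_prop)))).intervalIntegrable _ _
      · obtain ⟨i1, i2, i3⟩ := ih' u hu
        obtain ⟨b1, b2⟩ := hb u hu
        calc convChain g m u * g (m + 1) (t - u)
            ≤ (α ^ (m + 1) * convChain h m u) * (α * h (m + 1) (t - u)) := by
              refine mul_le_mul i3 (hgh _ le_rfl _ b1 b2) (hg0 _ le_rfl _ b1 b2) (by positivity)
          _ = _ := by ring

/-- If all factors are known up to a relative error `ε`, then so is the convolution, up to a
relative error `(1 + ε) ^ (m + 1) - 1`. -/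
lemma abs_convChain_sub_le {g h : ℕ → ℝ → ℝ} (hg : ∀ q, Continuous (g q))
    (hh : ∀ q, Continuous (h q)) {x ε : ℝ} (hε : 0 ≤ ε) (hε1 : ε ≤ 1) {m : ℕ}
    (h0 : ∀ q ≤ m, ∀ t, 0 ≤ t → t ≤ x → 0 ≤ h q t)
    (hgh : ∀ q ≤ m, ∀ t, 0 ≤ t → t ≤ x → |g q t - h q t| ≤ ε * h q t) (hx : 0 ≤ x) :
    |convChain g m x - convChain h m x| ≤ ((1 + ε) ^ (m + 1) - 1) * convChain h m x := by
  have hg0 : ∀ q ≤ m, ∀ t, 0 ≤ t → t ≤ x → 0 ≤ g q t := fun q hq t ht htx => by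
    have := (abs_le.1 (hgh q hq t ht htx)).1
    nlinarith [h0 q hq t ht htx]
  have up := convChain_le_mul hg hh (α := 1 + ε) (by linarith) hg0 h0 (fun q hq t ht htx => by
    linarith [(abs_le.1 (hgh q hq t ht htx)).2]) hx le_rfl
  have hscale : ∀ k t, convChain (fun q t => (1 - ε) * h q t) k t
      = (1 - ε) ^ (k + 1) * convChain h k t := by
    intro k
    induction k with
    | zero => intro t; simp [convChain]
    | succ k ih =>
      intro t
      simp only [convChain, halfConv, ih]
      rw [← intervalIntegral.integral_const_mul]
      congr 1; ext u; ring
  -- The lower bound is the upper bound for the pair `(1 - ε) h ≤ g` with constant `1`.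
  have lo := convChain_le_mul (g := fun q t => (1 - ε) * h q t) (h := g) (α := 1)
    (fun q => continuous_const.mul (hh q)) hg zero_le_one (m := m) (x := x)
    (fun q hq t ht htx => mul_nonneg (by linarith) (h0 q hq t ht htx)) hg0
    (fun q hq t ht htx => by linarith [(abs_le.1 (hgh q hq t ht htx)).1]) hx le_rfl
  rw [hscale, one_pow, one_mul] at lo
  -- Bernoulli's inequality on both sides of `(m + 1) ε`: the downward deviation never exceeds the
  -- upward one.
  have hb : 1 - (1 - ε) ^ (m + 1) ≤ (1 + ε) ^ (m + 1) - 1 := by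
    have b1 := one_add_mul_le_pow (a := ε) (by linarith) (m + 1)
    have b2 := one_add_mul_le_pow (a := -ε) (by linarith) (m + 1)
    rw [← sub_eq_add_neg] at b2
    push_cast at b1 b2
    linarith
  rw [abs_le]
  constructor
  · nlinarith [mul_le_mul_of_nonneg_right hb up.2.1, lo.2.2]
  · linarith [up.2.2]

/-! ### Convolutions of exponential sums and partial fractions -/

lemma integral_exp_mul_exp {p ν : ℝ} (h : p ≠ ν) (t : ℝ) :
    ∫ u in (0)..t, Real.exp (-(p * u)) * Real.exp (-(ν * (t - u))) =
      (Real.exp (-(p * t)) - Real.exp (-(ν * t))) / (ν - p) := by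
  have hne : ν - p ≠ 0 := sub_ne_zero.2 h.symm
  have hd : ∀ u ∈ Set.uIcc 0 t, HasDerivAt
      (fun u => Real.exp (-(ν * t)) * Real.exp ((ν - p) * u) / (ν - p))
      (Real.exp (-(p * u)) * Real.exp (-(ν * (t - u)))) u := by
    intro u _
    have h1 : HasDerivAt (fun u => (ν - p) * u) (ν - p) u := by
      simpa using (hasDerivAt_id u).const_mul (ν - p)
    refine ((h1.exp.const_mul (Real.exp (-(ν * t)))).div_const (ν - p)).congr_deriv ?_
    rw [← mul_assoc, mul_div_assoc, div_self hne, mul_one, ← Real.exp_add, ← Real.exp_add]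
    congr 1; ring
  rw [intervalIntegral.integral_eq_sub_of_hasDerivAt hd
    ((by fun_prop : Continuous _).intervalIntegrable _ _)]
  rw [mul_zero, Real.exp_zero, ← Real.exp_add, mul_one, ← sub_div]
  congr 3; ring

/-- Distinct rates exclude terms `t exp(-μt)`. The new coefficient at a pole is the old one times
the Laplace transform of the other factor there, evaluated at minus the pole. -/
lemma halfConv_exp_sum {ι κ : Type*} (s : Finset ι) (s' : Finset κ) (c μ : ι → ℝ) (d ν : κ → ℝ)
    (hne : ∀ i ∈ s, ∀ j ∈ s', μ i ≠ ν j) (t : ℝ) :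
    halfConv (fun u => ∑ i ∈ s, c i * Real.exp (-(μ i * u)))
        (fun u => ∑ j ∈ s', d j * Real.exp (-(ν j * u))) t =
      ∑ i ∈ s, (c i * ∑ j ∈ s', d j / (ν j - μ i)) * Real.exp (-(μ i * t)) +
        ∑ j ∈ s', (d j * ∑ i ∈ s, c i / (μ i - ν j)) * Real.exp (-(ν j * t)) := by
  unfold halfConv
  have e1 : ∀ u, (∑ i ∈ s, c i * Real.exp (-(μ i * u))) *
      (∑ j ∈ s', d j * Real.exp (-(ν j * (t - u)))) = ∑ i ∈ s, ∑ j ∈ s', (c i * d j) *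
        (Real.exp (-(μ i * u)) * Real.exp (-(ν j * (t - u)))) := fun u => by
    rw [Finset.sum_mul_sum]
    exact Finset.sum_congr rfl fun i _ => Finset.sum_congr rfl fun j _ => by ring
  simp only [e1]
  rw [intervalIntegral.integral_finsetSum
    fun i _ => (by fun_prop : Continuous _).intervalIntegrable _ _]
  have e2 : ∀ i ∈ s, ∫ u in (0)..t, ∑ j ∈ s', (c i * d j) *
        (Real.exp (-(μ i * u)) * Real.exp (-(ν j * (t - u)))) =
      ∑ j ∈ s', (c i * (d j / (ν j - μ i)) * Real.exp (-(μ i * t)) +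
        d j * (c i / (μ i - ν j)) * Real.exp (-(ν j * t))) := fun i hi => by
    rw [intervalIntegral.integral_finsetSum
      fun i _ => (by fun_prop : Continuous _).intervalIntegrable _ _]
    refine Finset.sum_congr rfl fun j hj => ?_
    rw [intervalIntegral.integral_const_mul, integral_exp_mul_exp (hne i hi j hj)]
    have h1 : ν j - μ i ≠ 0 := sub_ne_zero.2 (hne i hi j hj).symm
    rw [← neg_sub (ν j) (μ i)]
    field_simp
    ring
  rw [Finset.sum_congr rfl e2]
  simp only [Finset.sum_add_distrib]
  congr 1
  · exact Finset.sum_congr rfl fun i _ => by rw [Finset.mul_sum, Finset.sum_mul]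
  · rw [Finset.sum_comm]
    exact Finset.sum_congr rfl fun i _ => by rw [Finset.mul_sum, Finset.sum_mul]

/-- The Laplace side of `halfConv_exp_sum`, with the same coefficients; termwise it is `1/((μ - p)(ν
- p)) = (1/(ν - μ)) (1/(μ - p) - 1/(ν - p))`. -/
lemma sum_mul_sum_partialFraction {ι κ : Type*} (s : Finset ι) (s' : Finset κ) (c μ : ι → ℝ)
    (d ν : κ → ℝ) (hne : ∀ i ∈ s, ∀ j ∈ s', μ i ≠ ν j) {p : ℝ} (hμ : ∀ i ∈ s, μ i ≠ p)
    (hν : ∀ j ∈ s', ν j ≠ p) :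
    ∑ i ∈ s, (c i * ∑ j ∈ s', d j / (ν j - μ i)) / (μ i - p) +
        ∑ j ∈ s', (d j * ∑ i ∈ s, c i / (μ i - ν j)) / (ν j - p) =
      (∑ i ∈ s, c i / (μ i - p)) * ∑ j ∈ s', d j / (ν j - p) := by
  rw [Finset.sum_mul_sum]
  simp only [Finset.mul_sum, Finset.sum_div]
  rw [Finset.sum_comm (s := s') (t := s), ← Finset.sum_add_distrib]
  refine Finset.sum_congr rfl fun i hi => ?_
  rw [← Finset.sum_add_distrib]
  refine Finset.sum_congr rfl fun j hj => ?_
  have h1 : ν j - μ i ≠ 0 := sub_ne_zero.2 (hne i hi j hj).symm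
  have h2 : μ i - p ≠ 0 := sub_ne_zero.2 (hμ i hi)
  have h3 : ν j - p ≠ 0 := sub_ne_zero.2 (hν j hj)
  rw [← neg_sub (ν j) (μ i)]
  field_simp
  ring

section ExpMixture

/-- The exponential mixture `∑ k < N, ω q * exp (-(μ q k * t))`. -/
noncomputable def expMixture (N : ℕ) (ω : ℕ → ℝ) (μ : ℕ → ℕ → ℝ) (q : ℕ) (t : ℝ) : ℝ :=
  ∑ k ∈ Finset.range N, ω q * Real.exp (-(μ q k * t))

/-- The Laplace transform of `expMixture`, at the point `-p`. -/
noncomputable def mixtureLaplace (N : ℕ) (ω : ℕ → ℝ) (μ : ℕ → ℕ → ℝ) (q : ℕ) (p : ℝ) : ℝ :=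
  ∑ k ∈ Finset.range N, ω q / (μ q k - p)

/-- The coefficient of `exp (-(μ q k * t))` in the convolution of the mixtures `0, …, m`. -/
noncomputable def mixtureCoeff (N : ℕ) (ω : ℕ → ℝ) (μ : ℕ → ℕ → ℝ) (m : ℕ) (i : ℕ × ℕ) : ℝ :=
  ω i.1 * ∏ q ∈ (Finset.range (m + 1)).erase i.1, mixtureLaplace N ω μ q (μ i.1 i.2)

variable {N : ℕ} {ω : ℕ → ℝ} {μ : ℕ → ℕ → ℝ}

lemma mixtureCoeff_succ {m : ℕ} {i : ℕ × ℕ} (hi : i.1 < m + 1) :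
    mixtureCoeff N ω μ (m + 1) i =
      mixtureCoeff N ω μ m i * mixtureLaplace N ω μ (m + 1) (μ i.1 i.2) := by
  unfold mixtureCoeff
  rw [Finset.range_add_one (n := m + 1), Finset.erase_insert_of_ne (by omega),
    Finset.prod_insert (by simp)]
  ring

lemma mixtureCoeff_self (m k : ℕ) :
    mixtureCoeff N ω μ (m + 1) (m + 1, k) =
      ω (m + 1) * ∏ q ∈ Finset.range (m + 1), mixtureLaplace N ω μ q (μ (m + 1) k) := by
  unfold mixtureCoeff
  rw [Finset.range_add_one (n := m + 1), Finset.erase_insert (by simp)]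

lemma sum_range_succ_product (m : ℕ) (F : ℕ × ℕ → ℝ) :
    ∑ i ∈ Finset.range (m + 1) ×ˢ Finset.range N, F i =
      ∑ i ∈ Finset.range m ×ˢ Finset.range N, F i + ∑ k ∈ Finset.range N, F (m, k) := by
  rw [Finset.sum_product, Finset.sum_product, Finset.sum_range_succ]

/-- The Laplace transform of the convolution is the product of the transforms. The induction in
`convChain_expMixture` needs it to evaluate the coefficients at the poles of the newly added factor.
-/
lemma sum_mixtureCoeff_div : ∀ (m : ℕ) (_ : ∀ q ≤ m, ∀ q' ≤ m, q ≠ q' → ∀ k < N, ∀ k' < N,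
      μ q k ≠ μ q' k') (p : ℝ) (_ : ∀ q ≤ m, ∀ k < N, μ q k ≠ p),
    ∑ i ∈ Finset.range (m + 1) ×ˢ Finset.range N, mixtureCoeff N ω μ m i / (μ i.1 i.2 - p) =
      ∏ q ∈ Finset.range (m + 1), mixtureLaplace N ω μ q p
  | 0, _, p, _ => by
    rw [sum_range_succ_product]
    simp [mixtureCoeff, mixtureLaplace]
  | m + 1, hne, p, hp => by
    have ih := sum_mixtureCoeff_div m fun q hq q' hq' => hne q (by omega) q' (by omega)
    rw [sum_range_succ_product, Finset.prod_range_succ,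
      ← ih p fun q hq => hp q (by omega)]
    have := sum_mul_sum_partialFraction (Finset.range (m + 1) ×ˢ Finset.range N) (Finset.range N)
      (mixtureCoeff N ω μ m) (fun i => μ i.1 i.2) (fun _ => ω (m + 1)) (μ (m + 1)) (p := p)
      (fun i hi j hj => by
        simp only [Finset.mem_product, Finset.mem_range] at hi hj
        exact hne _ (by omega) _ le_rfl (by omega) _ hi.2 _ hj)
      (fun i hi => by
        simp only [Finset.mem_product, Finset.mem_range] at hi
        exact hp _ (by omega) _ hi.2)
      (fun j hj => hp _ le_rfl _ (Finset.mem_range.1 hj))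
    rw [mixtureLaplace, ← this]
    congr 1
    · refine Finset.sum_congr rfl fun i hi => ?_
      simp only [Finset.mem_product, Finset.mem_range] at hi
      rw [mixtureCoeff_succ hi.1, mixtureLaplace]
    · refine Finset.sum_congr rfl fun k hk => ?_
      rw [mixtureCoeff_self, ih]
      intro q hq k' hk'
      exact hne q (by omega) _ le_rfl (by omega) _ hk' _ (Finset.mem_range.1 hk)

lemma convChain_expMixture : ∀ (m : ℕ) (_ : ∀ q ≤ m, ∀ q' ≤ m, q ≠ q' → ∀ k < N, ∀ k' < N,
      μ q k ≠ μ q' k') (t : ℝ),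
    convChain (expMixture N ω μ) m t = ∑ i ∈ Finset.range (m + 1) ×ˢ Finset.range N,
      mixtureCoeff N ω μ m i * Real.exp (-(μ i.1 i.2 * t))
  | 0, _, t => by
    rw [sum_range_succ_product]
    simp [mixtureCoeff, convChain, expMixture]
  | m + 1, hne, t => by
    have hne' : ∀ q ≤ m, ∀ q' ≤ m, q ≠ q' → ∀ k < N, ∀ k' < N, μ q k ≠ μ q' k' :=
      fun q hq q' hq' => hne q (by omega) q' (by omega)
    have ih := convChain_expMixture m hne'
    rw [convChain, funext ih, sum_range_succ_product]
    have := halfConv_exp_sum (Finset.range (m + 1) ×ˢ Finset.range N) (Finset.range N)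
      (mixtureCoeff N ω μ m) (fun i => μ i.1 i.2) (fun _ => ω (m + 1)) (μ (m + 1))
      (fun i hi j hj => by
        simp only [Finset.mem_product, Finset.mem_range] at hi hj
        exact hne _ (by omega) _ le_rfl (by omega) _ hi.2 _ hj) t
    refine Eq.trans this ?_
    congr 1
    · refine Finset.sum_congr rfl fun i hi => ?_
      simp only [Finset.mem_product, Finset.mem_range] at hi
      rw [mixtureCoeff_succ hi.1, mixtureLaplace]
    · refine Finset.sum_congr rfl fun k hk => ?_
      rw [mixtureCoeff_self, sum_mixtureCoeff_div m hne']
      intro q hq k' hk'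
      exact hne q (by omega) _ le_rfl (by omega) _ hk' _ (Finset.mem_range.1 hk)

end ExpMixture

/-! ### Convolutions of gamma laws -/

lemma lintegral_eq_lintegral_comp_mul_left (f : ℝ → ENNReal) {a : ℝ} (ha : 0 < a)
    (hf : Measurable f) : ∫⁻ v, f v = ∫⁻ u, ENNReal.ofReal a * f (a * u) := by
  conv_lhs => rw [← Real.smul_map_volume_mul_left ha.ne', abs_of_pos ha]
  rw [lintegral_smul_measure, lintegral_map hf (by fun_prop), smul_eq_mul, lintegral_const_mul]
  fun_prop

@[fun_prop]
lemma measurable_gammaPDF (s ρ : ℝ) : Measurable (gammaPDF s ρ) :=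
  (measurable_gammaPDFReal s ρ).ennreal_ofReal

@[fun_prop]
lemma measurable_betaPDF (s ρ : ℝ) : Measurable (betaPDF s ρ) :=
  (measurable_betaPDFReal s ρ).ennreal_ofReal

lemma map_mul_gammaMeasure {s ρ a : ℝ} (hρ : 0 < ρ) (ha : 0 < a) :
    (gammaMeasure s ρ).map (a * ·) = gammaMeasure s (ρ / a) := by
  ext S hS
  rw [Measure.map_apply (by fun_prop) hS, gammaMeasure, gammaMeasure,
    withDensity_apply _ (hS.preimage (by fun_prop)), withDensity_apply _ hS,
    ← lintegral_indicator (hS.preimage (by fun_prop)), ← lintegral_indicator hS,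
    lintegral_eq_lintegral_comp_mul_left _ ha ((measurable_gammaPDF _ _).indicator hS)]
  congr 1; ext u
  by_cases hu : a * u ∈ S
  · rw [Set.indicator_of_mem (show u ∈ (fun x => a * x) ⁻¹' S from hu), Set.indicator_of_mem hu]
    rcases lt_or_ge u 0 with h | h
    · rw [gammaPDF_of_neg h, gammaPDF_of_neg (mul_neg_of_pos_of_neg ha h), mul_zero]
    · rw [gammaPDF_of_nonneg h, gammaPDF_of_nonneg (by positivity), ← ENNReal.ofReal_mul ha.le]
      congr 1
      rw [Real.div_rpow hρ.le ha.le, Real.mul_rpow ha.le h, Real.rpow_sub_one ha.ne']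
      have : ρ / a * (a * u) = ρ * u := by field_simp
      rw [this]
      have : a ^ s ≠ 0 := (Real.rpow_pos_of_pos ha s).ne'
      field_simp
  · rw [Set.indicator_of_notMem (show u ∉ (fun x => a * x) ⁻¹' S from hu),
      Set.indicator_of_notMem hu, mul_zero]

lemma lconvolution_gammaPDF_of_neg {s s' ρ σ z : ℝ} (hz : z < 0) :
    (gammaPDF s ρ ⋆ₗ gammaPDF s' σ) z = 0 := by
  rw [lconvolution_def]
  refine (lintegral_congr fun u => ?_).trans lintegral_zero
  rcases lt_or_ge u 0 with h | h
  · rw [gammaPDF_of_neg h, zero_mul]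
  · rw [gammaPDF_of_neg (by linarith : -u + z < 0), mul_zero]

/-- The substitution `u = z v` turns the convolution into an average over a beta law. Equal rates
give additivity of the shapes; shapes `1/2` give the arcsine law and hence the Bessel factor of
`pairDensity`. -/
lemma lconvolution_gammaPDF {s s' ρ σ z : ℝ} (hs : 0 < s) (hs' : 0 < s') (hρ : 0 < ρ) (hσ : 0 < σ)
    (hz : 0 < z) : (gammaPDF s ρ ⋆ₗ gammaPDF s' σ) z =
      ENNReal.ofReal (ρ ^ s * σ ^ s' / Real.Gamma (s + s') * z ^ (s + s' - 1)) *
        ∫⁻ v, betaPDF s s' v * ENNReal.ofReal (Real.exp (-(z * (ρ * v + σ * (1 - v))))) := by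
  rw [lconvolution_def, lintegral_eq_lintegral_comp_mul_left
    (fun y => gammaPDF s ρ y * gammaPDF s' σ (-y + z)) hz (by fun_prop),
    ← lintegral_const_mul _ (by fun_prop)]
  refine lintegral_congr_ae ?_
  have h0 : ∀ᵐ v : ℝ, v ≠ 0 := by simp [ae_iff]
  have h1 : ∀ᵐ v : ℝ, v ≠ 1 := by simp [ae_iff]
  filter_upwards [h0, h1] with v hv0 hv1
  rcases lt_or_gt_of_ne hv0 with h | h
  · rw [gammaPDF_of_neg (mul_neg_of_pos_of_neg hz h), betaPDF_eq_zero_of_nonpos h.le]; simp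
  rcases lt_or_gt_of_ne hv1 with h' | h'
  swap
  · rw [gammaPDF_of_neg (x := -(z * v) + z) (by nlinarith), betaPDF_eq_zero_of_one_le h'.le]; simp
  have e1 : -(z * v) + z = z * (1 - v) := by ring
  have hv' : 0 < 1 - v := by linarith
  rw [e1, gammaPDF_of_nonneg (by positivity), gammaPDF_of_nonneg (by positivity),
    betaPDF_of_pos_lt_one h h']
  have hG := Real.Gamma_pos_of_pos hs
  have hG' := Real.Gamma_pos_of_pos hs'
  have hG'' := Real.Gamma_pos_of_pos (add_pos hs hs')
  have hb := beta_pos hs hs'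
  rw [← ENNReal.ofReal_mul (by positivity), ← ENNReal.ofReal_mul (by positivity),
    ← ENNReal.ofReal_mul (by positivity), ← ENNReal.ofReal_mul (by positivity)]
  congr 1
  have e2 : Real.exp (-(z * (ρ * v + σ * (1 - v)))) =
      Real.exp (-(ρ * (z * v))) * Real.exp (-(σ * (z * (1 - v)))) := by
    rw [← Real.exp_add]; congr 1; ring
  have e3 : z ^ (s + s' - 1) = z * z ^ (s - 1) * z ^ (s' - 1) := by
    rw [show s + s' - 1 = 1 + (s - 1) + (s' - 1) by ring, Real.rpow_add hz, Real.rpow_add hz,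
      Real.rpow_one]
  rw [e2, e3, Real.mul_rpow hz.le h.le, Real.mul_rpow hz.le hv'.le, beta]
  field_simp

lemma conv_gammaMeasure {s s' ρ : ℝ} (hs : 0 < s) (hs' : 0 < s') (hρ : 0 < ρ) :
    gammaMeasure s ρ ∗ gammaMeasure s' ρ = gammaMeasure (s + s') ρ := by
  rw [gammaMeasure, gammaMeasure, gammaMeasure, conv_withDensity_eq_lconvolution
    (measurable_gammaPDF _ _) (measurable_gammaPDF _ _)]
  refine withDensity_congr_ae ?_
  have h0 : ∀ᵐ v : ℝ, v ≠ 0 := by simp [ae_iff]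
  filter_upwards [h0] with z hz
  rcases lt_or_gt_of_ne hz with h | h
  · rw [lconvolution_gammaPDF_of_neg h, gammaPDF_of_neg h]
  rw [lconvolution_gammaPDF hs hs' hρ hρ h, gammaPDF_of_nonneg h.le]
  have : ∀ v : ℝ, z * (ρ * v + ρ * (1 - v)) = ρ * z := fun v => by ring
  simp only [this]
  rw [lintegral_mul_const _ (measurable_betaPDF _ _), lintegral_betaPDF_eq_one hs hs', one_mul,
    ← ENNReal.ofReal_mul, ← Real.rpow_add hρ]
  have hG'' := Real.Gamma_pos_of_pos (add_pos hs hs')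
  positivity

instance isProbabilityMeasure_chiSq_one : IsProbabilityMeasure (chiSq 1) :=
  isProbabilityMeasure_gammaMeasure (by norm_num) (by norm_num)

lemma charFun_chiSq {r : ℕ} (hr : 0 < r) (t : ℝ) :
    charFun (chiSq r) t = charFun (chiSq 1) t ^ r := by
  induction r, hr using Nat.le_induction with
  | base => simp
  | succ r hr ih =>
    have h1 : IsProbabilityMeasure (chiSq r) :=
      isProbabilityMeasure_gammaMeasure (by have : 0 < r := hr; positivity) (by norm_num)
    have : chiSq (r + 1) = chiSq r ∗ chiSq 1 := by
      unfold chiSq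
      rw [conv_gammaMeasure (by have : 0 < r := hr; positivity) (by norm_num) (by norm_num)]
      congr 1; push_cast; ring
    rw [this, charFun_conv, ih, pow_succ]

/-! ### The density of `a X + b Y` for one degree of freedom -/

/-- The density at `t ≥ 0` of `a X + b Y`, where `X`, `Y` are independent and chi-square distributed
with one degree of freedom. -/
noncomputable def pairDensity (a b t : ℝ) : ℝ :=
  1 / (2 * √(a * b)) * Real.exp (-((1 / a + 1 / b) / 4 * t)) *
    arcMean (fun x => Real.exp ((1 / a - 1 / b) / 4 * t * x))

lemma continuous_pairDensity (a b : ℝ) : Continuous (pairDensity a b) := by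
  unfold pairDensity
  exact (by fun_prop : Continuous _).mul (continuous_arcMean_exp.comp (by fun_prop))

lemma pairDensity_pos {a b : ℝ} (ha : 0 < a) (hb : 0 < b) (t : ℝ) : 0 < pairDensity a b t := by
  unfold pairDensity
  have := one_le_arcMean_exp ((1 / a - 1 / b) / 4 * t)
  positivity

/-- Under `v = (1 - cos θ)/2` the density `1/(π√(v(1 - v)))` becomes the constant `1/π` on `(0, π)`.
-/
lemma lintegral_betaPDF_half_mul {g : ℝ → ℝ} (hg : Continuous g) (hg0 : ∀ v, 0 ≤ g v) :
    ∫⁻ v, betaPDF (1 / 2) (1 / 2) v * ENNReal.ofReal (g v) =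
      ENNReal.ofReal (arcMean fun x => g ((1 - x) / 2)) := by
  have hbeta : beta (1 / 2) (1 / 2) = Real.pi := by
    rw [beta, Real.Gamma_one_half_eq, ← Real.sqrt_mul Real.pi_pos.le, Real.sqrt_mul_self Real.pi_pos.le]
    norm_num
  have himage : (fun θ => (1 - Real.cos θ) / 2) '' Set.Ioo 0 Real.pi = Set.Ioo 0 1 := by
    ext v
    constructor
    · rintro ⟨θ, hθ, rfl⟩
      have h1 := Real.strictAntiOn_cos ⟨le_rfl, Real.pi_pos.le⟩ ⟨hθ.1.le, hθ.2.le⟩ hθ.1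
      have h2 := Real.strictAntiOn_cos ⟨hθ.1.le, hθ.2.le⟩ ⟨Real.pi_pos.le, le_rfl⟩ hθ.2
      rw [Real.cos_zero] at h1
      rw [Real.cos_pi] at h2
      constructor <;> dsimp only <;> linarith
    · rintro ⟨h1, h2⟩
      refine ⟨Real.arccos (1 - 2 * v), ⟨?_, ?_⟩, ?_⟩
      · exact Real.arccos_pos.2 (by linarith)
      · refine lt_of_le_of_ne (Real.arccos_le_pi _) fun h => ?_
        rw [Real.arccos_eq_pi] at h; linarith
      · dsimp only
        rw [Real.cos_arccos (by linarith) (by linarith)]; ring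
  have hzero : ∀ v ∉ Set.Ioo (0 : ℝ) 1, betaPDF (1 / 2) (1 / 2) v = 0 := fun v hv => by
    rcases le_or_gt v 0 with h | h
    · exact betaPDF_eq_zero_of_nonpos h
    · exact betaPDF_eq_zero_of_one_le (not_lt.1 fun h' => hv ⟨h, h'⟩)
  have hset : ∫⁻ v, betaPDF (1 / 2) (1 / 2) v * ENNReal.ofReal (g v) =
      ∫⁻ v in Set.Ioo 0 1, betaPDF (1 / 2) (1 / 2) v * ENNReal.ofReal (g v) := by
    rw [← lintegral_indicator measurableSet_Ioo]
    congr 1; ext v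
    by_cases hv : v ∈ Set.Ioo (0 : ℝ) 1
    · rw [Set.indicator_of_mem hv]
    · rw [Set.indicator_of_notMem hv, hzero v hv, zero_mul]
  rw [hset, ← himage, lintegral_image_eq_lintegral_abs_deriv_mul measurableSet_Ioo
    (f' := fun θ => Real.sin θ / 2)
    (fun θ _ => by
      have := ((Real.hasDerivAt_cos θ).const_sub 1).div_const 2
      rw [neg_neg] at this
      exact this.hasDerivWithinAt)
    (fun θ hθ θ' hθ' h => by
      exact Real.injOn_cos ⟨hθ.1.le, hθ.2.le⟩ ⟨hθ'.1.le, hθ'.2.le⟩ (by simpa using h))]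
  have hpt : ∀ θ ∈ Set.Ioo 0 Real.pi, ENNReal.ofReal |Real.sin θ / 2| *
      (betaPDF (1 / 2) (1 / 2) ((1 - Real.cos θ) / 2) * ENNReal.ofReal (g ((1 - Real.cos θ) / 2)))
      = ENNReal.ofReal (1 / Real.pi * g ((1 - Real.cos θ) / 2)) := by
    intro θ hθ
    have hmem : (1 - Real.cos θ) / 2 ∈ Set.Ioo (0 : ℝ) 1 := himage ▸ ⟨θ, hθ, rfl⟩
    have hsin := Real.sin_pos_of_mem_Ioo hθ
    obtain ⟨m1, m2⟩ := hmem
    rw [betaPDF_of_pos_lt_one m1 m2, hbeta, abs_of_pos (by positivity)]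
    rw [← ENNReal.ofReal_mul (by have := sub_pos.2 m2; positivity),
      ← ENNReal.ofReal_mul (by positivity)]
    congr 1
    have e : ((1 - Real.cos θ) / 2) ^ ((1 : ℝ) / 2 - 1) * (1 - (1 - Real.cos θ) / 2) ^ ((1 : ℝ) / 2 - 1)
        = (Real.sin θ / 2)⁻¹ := by
      rw [← Real.mul_rpow m1.le (by linarith)]
      have : (1 - Real.cos θ) / 2 * (1 - (1 - Real.cos θ) / 2) = (Real.sin θ / 2) ^ 2 := by
        nlinarith [Real.sin_sq_add_cos_sq θ]
      rw [this, ← Real.rpow_natCast, ← Real.rpow_mul (by positivity), ← Real.rpow_neg_one]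
      norm_num
    have hne : Real.sin θ / 2 ≠ 0 := by positivity
    calc _ = (Real.sin θ / 2) * (((1 - Real.cos θ) / 2) ^ ((1 : ℝ) / 2 - 1) *
            (1 - (1 - Real.cos θ) / 2) ^ ((1 : ℝ) / 2 - 1)) *
            (1 / Real.pi * g ((1 - Real.cos θ) / 2)) := by ring
      _ = _ := by rw [e, mul_inv_cancel₀ hne, one_mul]
  rw [setLIntegral_congr_fun measurableSet_Ioo hpt]
  unfold arcMean
  rw [intervalIntegral.integral_of_le Real.pi_pos.le, integral_Ioc_eq_integral_Ioo,
    ← integral_const_mul]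
  rw [ofReal_integral_eq_lintegral_ofReal]
  · have hc : Continuous fun θ => 1 / Real.pi * g ((1 - Real.cos θ) / 2) := by fun_prop
    exact (hc.integrableOn_Icc (a := 0) (b := Real.pi)).mono_set Set.Ioo_subset_Icc_self
  · exact Filter.Eventually.of_forall fun θ => by
      have := hg0 ((1 - Real.cos θ) / 2)
      have := Real.pi_pos
      dsimp only [Pi.zero_apply]
      positivity

/-- The measure on the positive half line with density `F`. -/
noncomputable def halfDensity (F : ℝ → ℝ) : Measure ℝ :=
  volume.withDensity fun z => ENNReal.ofReal ((Set.Ici 0).indicator F z)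

lemma conv_map_chiSq_one {a b : ℝ} (ha : 0 < a) (hb : 0 < b) :
    (chiSq 1).map (a * ·) ∗ (chiSq 1).map (b * ·) = halfDensity (pairDensity a b) := by
  unfold chiSq halfDensity
  rw [map_mul_gammaMeasure (by norm_num) ha, map_mul_gammaMeasure (by norm_num) hb, gammaMeasure,
    gammaMeasure, conv_withDensity_eq_lconvolution
    (measurable_gammaPDF _ _) (measurable_gammaPDF _ _)]
  refine withDensity_congr_ae ?_
  have h0 : ∀ᵐ v : ℝ, v ≠ 0 := by simp [ae_iff]
  filter_upwards [h0] with z hz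
  rw [Nat.cast_one]
  rcases lt_or_gt_of_ne hz with h | h
  · rw [lconvolution_gammaPDF_of_neg h, Set.indicator_of_notMem (by simpa using h)]; simp
  rw [lconvolution_gammaPDF (by norm_num) (by norm_num) (by positivity) (by positivity) h,
    Set.indicator_of_mem (by simpa using h.le)]
  rw [lintegral_betaPDF_half_mul (g := fun v => Real.exp (-(z * (1 / 2 / a * v + 1 / 2 / b * (1 - v)))))
    (by fun_prop) (fun v => by positivity)]
  rw [← ENNReal.ofReal_mul (by norm_num; positivity)]
  congr 1
  have e1 : ∀ x : ℝ, Real.exp (-(z * (1 / 2 / a * ((1 - x) / 2) + 1 / 2 / b * (1 - (1 - x) / 2)))) =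
      Real.exp (-((1 / a + 1 / b) / 4 * z)) * Real.exp ((1 / a - 1 / b) / 4 * z * x) := fun x => by
    rw [← Real.exp_add]; congr 1; field_simp; ring
  simp only [e1]
  rw [arcMean_const_mul, pairDensity, ← mul_assoc]
  congr 2
  have e2 : (1 : ℝ) / 2 + 1 / 2 = 1 := by norm_num
  rw [e2, sub_self, Real.rpow_zero, Real.Gamma_one, div_one, mul_one,
    ← Real.mul_rpow (by positivity) (by positivity), ← Real.sqrt_eq_rpow]
  have e3 : 1 / 2 / a * (1 / 2 / b) = ((2 : ℝ)⁻¹) ^ 2 * (a * b)⁻¹ := by field_simp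
  rw [e3, Real.sqrt_mul (by positivity), Real.sqrt_sq (by norm_num), Real.sqrt_inv]
  rw [one_div, mul_inv]

/-! ### Densities of sums -/

lemma measurable_indicator_Ici {F : ℝ → ℝ} (hF : Continuous F) :
    Measurable ((Set.Ici (0 : ℝ)).indicator F) :=
  hF.measurable.indicator measurableSet_Ici

lemma halfDensity_conv {F G : ℝ → ℝ} (hF : Continuous F) (hG : Continuous G)
    (hF0 : ∀ t, 0 ≤ t → 0 ≤ F t) (hG0 : ∀ t, 0 ≤ t → 0 ≤ G t) :
    halfDensity F ∗ halfDensity G = halfDensity (halfConv F G) := by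
  unfold halfDensity
  rw [conv_withDensity_eq_lconvolution (measurable_indicator_Ici hF).ennreal_ofReal
    (measurable_indicator_Ici hG).ennreal_ofReal]
  congr 1; ext z
  rw [lconvolution_def]
  have hpt : ∀ u, ENNReal.ofReal ((Set.Ici 0).indicator F u) *
      ENNReal.ofReal ((Set.Ici 0).indicator G (-u + z)) =
      (Set.Icc 0 z).indicator (fun u => ENNReal.ofReal (F u * G (z - u))) u := by
    intro u
    by_cases h : u ∈ Set.Icc 0 z
    · rw [Set.indicator_of_mem h, Set.indicator_of_mem (show u ∈ Set.Ici 0 from h.1),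
        Set.indicator_of_mem (show -u + z ∈ Set.Ici 0 from by simpa using h.2),
        ← ENNReal.ofReal_mul (hF0 _ h.1)]
      congr 3; ring
    · rw [Set.indicator_of_notMem h]
      by_cases h0 : 0 ≤ u
      · rw [Set.indicator_of_notMem (s := Set.Ici 0) (a := -u + z)]
        · simp
        · intro h'
          exact h ⟨h0, by simpa using h'⟩
      · rw [Set.indicator_of_notMem (s := Set.Ici 0) (a := u) (by simpa using h0)]
        simp
  rw [lintegral_congr hpt, lintegral_indicator measurableSet_Icc]
  rcases lt_or_ge z 0 with hz | hz
  · rw [Set.indicator_of_notMem (by simpa using hz), Set.Icc_eq_empty (by simpa using hz)]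
    simp
  · rw [Set.indicator_of_mem (show z ∈ Set.Ici 0 from hz), halfConv,
      intervalIntegral.integral_of_le hz, ← integral_Icc_eq_integral_Ioc,
      ofReal_integral_eq_lintegral_ofReal]
    · exact (by fun_prop : Continuous fun u => F u * G (z - u)).integrableOn_Icc
    · refine (ae_restrict_iff' measurableSet_Icc).2 (Filter.Eventually.of_forall fun u hu => ?_)
      exact mul_nonneg (hF0 _ hu.1) (hG0 _ (by linarith [hu.2]))

lemma charFun_halfDensity_convChain {g : ℕ → ℝ → ℝ} (hg : ∀ q, Continuous (g q))
    (hpos : ∀ q t, 0 ≤ t → 0 ≤ g q t) (hfin : ∀ q, IsProbabilityMeasure (halfDensity (g q))) (t : ℝ) :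
    ∀ m, IsProbabilityMeasure (halfDensity (convChain g m)) ∧
      charFun (halfDensity (convChain g m)) t =
        ∏ q ∈ Finset.range (m + 1), charFun (halfDensity (g q)) t
  | 0 => ⟨hfin 0, by simp [convChain]⟩
  | m + 1 => by
    obtain ⟨h1, h2⟩ := charFun_halfDensity_convChain hg hpos hfin t m
    have := hfin (m + 1)
    rw [convChain, ← halfDensity_conv (continuous_convChain hg m) (hg _)
      (convChain_nonneg hpos m) (hpos _), charFun_conv, h2, Finset.prod_range_succ (n := m + 1)]
    exact ⟨inferInstance, rfl⟩

/-- A function of the quotient, multiplied over `range (n * r)`. -/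
lemma prod_range_mul_div {M : Type*} [CommMonoid M] (φ : ℕ → M) (n : ℕ) {r : ℕ} (hr : 0 < r) :
    ∏ q ∈ Finset.range (n * r), φ (q / r) = ∏ j ∈ Finset.range n, φ j ^ r := by
  induction n with
  | zero => simp
  | succ n ih =>
    rw [Nat.succ_mul, Finset.prod_range_add, ih, Finset.prod_range_succ]
    congr 1
    rw [Finset.prod_congr rfl (g := fun _ => φ n), Finset.prod_const, Finset.card_range]
    intro d hd
    rw [mul_comm, Nat.mul_add_div hr, Nat.div_eq_of_lt (Finset.mem_range.1 hd), add_zero]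

/-- The weighted sum of chi-square variables has the iterated convolution of pair densities as its
density. Here `A`, `B` extend the coefficients to all natural numbers. -/
lemma map_sum_eq_halfDensity {n r : ℕ} (hn : 0 < n) (hr : 0 < r) {a b : Fin n → ℝ} {A B : ℕ → ℝ}
    (hA : ∀ i : Fin n, A i = a i) (hB : ∀ i : Fin n, B i = b i) (hA0 : ∀ q, 0 < A q) (hB0 : ∀ q, 0 < B q)
    {Ω : Type*} {_ : MeasurableSpace Ω} {μ : Measure Ω} [IsProbabilityMeasure μ]
    {X Y : Fin n → Ω → ℝ} (hX : ∀ i, HasLaw (X i) (chiSq r) μ)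
    (hY : ∀ i, HasLaw (Y i) (chiSq r) μ) (hind : iIndepFun (Sum.elim X Y) μ) :
    μ.map (fun ω => ∑ i, (a i * X i ω + b i * Y i ω)) =
      halfDensity (convChain (fun q => pairDensity (A (q / r)) (B (q / r))) (n * r - 1)) := by
  set W : Fin n ⊕ Fin n → Ω → ℝ := Sum.elim (fun i ω => a i * X i ω) (fun i ω => b i * Y i ω)
  have hW : iIndepFun W μ := by
    have := hind.comp (fun s : Fin n ⊕ Fin n => fun y : ℝ => Sum.elim a b s * y)
      (fun s => by fun_prop)
    convert this using 1
    ext s ω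
    rcases s with s | s <;> rfl
  have hWm : ∀ s, AEMeasurable (W s) μ := by
    rintro (s | s)
    · exact (hX s).aemeasurable.const_mul _
    · exact (hY s).aemeasurable.const_mul _
  have hsum : (fun ω => ∑ i, (a i * X i ω + b i * Y i ω)) = fun ω => ∑ s, W s ω := by
    ext ω
    rw [Fintype.sum_sum_type, Finset.sum_add_distrib]
    rfl
  have hmeas : AEMeasurable (fun ω => ∑ s, W s ω) μ := Finset.aemeasurable_fun_sum _ fun s _ => hWm s
  have hp1 : ∀ c : ℝ, IsProbabilityMeasure ((chiSq 1).map (c * ·)) := fun c =>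
    Measure.isProbabilityMeasure_map (by fun_prop)
  have hfin : ∀ q, IsProbabilityMeasure (halfDensity (pairDensity (A (q / r)) (B (q / r)))) := by
    intro q
    have := hp1 (A (q / r))
    have := hp1 (B (q / r))
    rw [← conv_map_chiSq_one (hA0 _) (hB0 _)]
    infer_instance
  have hcf := fun t => charFun_halfDensity_convChain (g := fun q => pairDensity (A (q / r)) (B (q / r)))
    (fun q => continuous_pairDensity _ _) (fun q t _ => (pairDensity_pos (hA0 _) (hB0 _) t).le) hfin t
      (n * r - 1)
  have := (hcf 0).1
  have := Measure.isProbabilityMeasure_map hmeas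
  rw [hsum]
  -- Characteristic functions avoid any splitting of the variables `X i`, `Y i` themselves: factor
  -- number `q` carries the pair `q / r`, so each pair occurs `r` times, matching the `r`-th power
  -- in `charFun_chiSq`.
  refine Measure.ext_of_charFun (funext fun t => ?_)
  rw [(hcf t).2, hW.charFun_map_fun_sum_eq_prod hWm, Finset.prod_apply, Fintype.prod_sum_type,
    ← Finset.prod_mul_distrib, Nat.sub_add_cancel (Nat.mul_pos hn hr),
    prod_range_mul_div (fun j => charFun (halfDensity (pairDensity (A j) (B j))) t) n hr,
    ← Fin.prod_univ_eq_prod_range]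
  refine Finset.prod_congr rfl fun i _ => ?_
  have := hp1 (A i)
  have := hp1 (B i)
  rw [← conv_map_chiSq_one (hA0 _) (hB0 _), charFun_conv, charFun_map_mul, charFun_map_mul, hA, hB,
    mul_pow, ← charFun_chiSq hr, ← charFun_chiSq hr]
  congr 1
  · change charFun (μ.map fun ω => a i * X i ω) t = _
    rw [charFun_map_mul_comp (hX i).aemeasurable, (hX i).map_eq]
  · change charFun (μ.map fun ω => b i * Y i ω) t = _
    rw [charFun_map_mul_comp (hY i).aemeasurable, (hY i).map_eq]

/-! ### Total correctness of real RAM programs -/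

namespace RealRAM

/-- Started in `s`, the program `P` halts at cost at most `B` in a store that satisfies `Post`. -/
def Runs (P : Prog) (s : Store) (B : ℕ) (Post : Store → Prop) : Prop :=
  ∃ t s', Exec P s t s' ∧ t ≤ B ∧ Post s'

/-- The natural-number variables to which a program assigns. -/
def Prog.natMods : Prog → List ℕ
  | .skip => []
  | .setNat v _ => [v]
  | .setReal _ _ _ => []
  | .seq p q => p.natMods ++ q.natMods
  | .ite _ p q => p.natMods ++ q.natMods
  | .loop _ p => p.natMods

/-- The real arrays to which a program assigns. -/
def Prog.realMods : Prog → List ℕ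
  | .skip => []
  | .setNat _ _ => []
  | .setReal A _ _ => [A]
  | .seq p q => p.realMods ++ q.realMods
  | .ite _ p q => p.realMods ++ q.realMods
  | .loop _ p => p.realMods

/-- The stores `s` and `s'` agree outside the variables and arrays to which `P` assigns. -/
def SameOutside (P : Prog) (s s' : Store) : Prop :=
  (∀ v ∉ P.natMods, s'.nat v = s.nat v) ∧ ∀ A ∉ P.realMods, s'.real A = s.real A

@[simp] lemma setNat_nat_self (s : Store) (v m : ℕ) : (s.setNat v m).nat v = m := by
  simp [Store.setNat]

lemma setNat_nat_of_ne (s : Store) {v w : ℕ} (m : ℕ) (h : w ≠ v) :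
    (s.setNat v m).nat w = s.nat w := by
  simp [Store.setNat, h]

@[simp] lemma setNat_real (s : Store) (v m : ℕ) : (s.setNat v m).real = s.real := rfl

@[simp] lemma setReal_nat (s : Store) (A k : ℕ) (y : ℝ) : (s.setReal A k y).nat = s.nat := rfl

@[simp] lemma setReal_real_self (s : Store) (A k : ℕ) (y : ℝ) :
    (s.setReal A k y).real A k = y := by
  simp [Store.setReal]

lemma setReal_real_of_ne (s : Store) {A A' : ℕ} (k : ℕ) (y : ℝ) (h : A' ≠ A) :
    (s.setReal A k y).real A' = s.real A' := by
  simp [Store.setReal, h]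

lemma setReal_real_cell_of_ne (s : Store) (A : ℕ) {k k' : ℕ} (y : ℝ) (h : k' ≠ k) :
    (s.setReal A k y).real A k' = s.real A k' := by
  simp [Store.setReal, h]

/-- The frame rule. The sets of modified variables and arrays are syntactic, so for concrete
programs its side conditions are settled by `decide`. -/
lemma Exec.sameOutside {P : Prog} {s s' : Store} {t : ℕ} (h : Exec P s t s') :
    SameOutside P s s' := by
  induction h with
  | skip s => exact ⟨fun _ _ => rfl, fun _ _ => rfl⟩
  | setNat s v e =>
    refine ⟨fun w hw => setNat_nat_of_ne _ _ ?_, fun _ _ => rfl⟩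
    simpa [Prog.natMods] using hw
  | setReal s A k e =>
    refine ⟨fun w hw => rfl, fun A' hA => setReal_real_of_ne _ _ _ ?_⟩
    simpa [Prog.realMods] using hA
  | seq _ _ ih₁ ih₂ =>
    constructor <;> intro v hv <;>
      simp only [Prog.natMods, Prog.realMods, List.mem_append, not_or] at hv
    · rw [ih₂.1 v hv.2, ih₁.1 v hv.1]
    · rw [ih₂.2 v hv.2, ih₁.2 v hv.1]
  | ite_true _ _ ih =>
    constructor <;> intro v hv <;>
      simp only [Prog.natMods, Prog.realMods, List.mem_append, not_or] at hv
    · exact ih.1 v hv.1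
    · exact ih.2 v hv.1
  | ite_false _ _ ih =>
    constructor <;> intro v hv <;>
      simp only [Prog.natMods, Prog.realMods, List.mem_append, not_or] at hv
    · exact ih.1 v hv.2
    · exact ih.2 v hv.2
  | loop_true _ _ _ ih₁ ih₂ =>
    constructor <;> intro v hv
    · rw [ih₂.1 v hv, ih₁.1 v hv]
    · rw [ih₂.2 v hv, ih₁.2 v hv]
  | loop_false _ => exact ⟨fun _ _ => rfl, fun _ _ => rfl⟩

lemma Runs.mono {P : Prog} {s : Store} {B B' : ℕ} {Post Post' : Store → Prop}
    (h : Runs P s B Post) (hB : B ≤ B') (hPost : ∀ s', SameOutside P s s' → Post s' → Post' s') :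
    Runs P s B' Post' := by
  obtain ⟨t, s', he, ht, hp⟩ := h
  exact ⟨t, s', he, ht.trans hB, hPost s' he.sameOutside hp⟩

lemma Runs.skip {s : Store} {B : ℕ} {Post : Store → Prop} (hB : 1 ≤ B) (h : Post s) :
    Runs .skip s B Post :=
  ⟨_, _, .skip s, hB, h⟩

lemma Runs.setNat {s : Store} {B v : ℕ} {e : NExpr} {Post : Store → Prop} (hB : e.cost + 1 ≤ B)
    (h : Post (s.setNat v (e.eval s))) : Runs (.setNat v e) s B Post :=
  ⟨_, _, .setNat s v e, hB, h⟩

lemma Runs.setReal {s : Store} {B A : ℕ} {k : NExpr} {e : RExpr} {Post : Store → Prop}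
    (hB : k.cost + e.cost + 1 ≤ B) (h : Post (s.setReal A (k.eval s) (e.eval s))) :
    Runs (.setReal A k e) s B Post :=
  ⟨_, _, .setReal s A k e, hB, h⟩

lemma Runs.seq {p q : Prog} {s : Store} {B B₁ B₂ : ℕ} {Post : Store → Prop}
    (h : Runs p s B₁ fun s' => Runs q s' B₂ Post) (hB : B₁ + B₂ ≤ B) :
    Runs (.seq p q) s B Post := by
  obtain ⟨t, s', he, ht, t', s'', he', ht', hp⟩ := h
  exact ⟨_, _, .seq he he', by omega, hp⟩

lemma Runs.seq_setNat {q : Prog} {s : Store} {B v : ℕ} {e : NExpr} {Post : Store → Prop}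
    (h : Runs q (s.setNat v (e.eval s)) B Post) :
    Runs (.seq (.setNat v e) q) s (e.cost + 1 + B) Post :=
  Runs.seq (Runs.setNat le_rfl h) le_rfl

lemma Runs.seq_setReal {q : Prog} {s : Store} {B A : ℕ} {k : NExpr} {e : RExpr}
    {Post : Store → Prop} (h : Runs q (s.setReal A (k.eval s) (e.eval s)) B Post) :
    Runs (.seq (.setReal A k e) q) s (k.cost + e.cost + 1 + B) Post :=
  Runs.seq (Runs.setReal le_rfl h) le_rfl

lemma Runs.ite {c : Test} {p q : Prog} {s : Store} {B B' : ℕ} {Post : Store → Prop}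
    (h₁ : c.Holds s → Runs p s B Post) (h₂ : ¬ c.Holds s → Runs q s B Post)
    (hB : c.cost + B ≤ B') : Runs (.ite c p q) s B' Post := by
  by_cases h : c.Holds s
  · obtain ⟨t, s', he, ht, hp⟩ := h₁ h
    exact ⟨_, _, .ite_true h he, by omega, hp⟩
  · obtain ⟨t, s', he, ht, hp⟩ := h₂ h
    exact ⟨_, _, .ite_false h he, by omega, hp⟩

/-- `for i in 0, …, m - 1 do body`, where `i` and `m` are natural-number variables. -/
def forLoop (i m : ℕ) (body : Prog) : Prog :=
  .seq (.setNat i (.lit 0))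
    (.loop (.natLt (.var i) (.var m)) (.seq body (.setNat i (.add (.var i) (.lit 1)))))

/-- Each round adds `7` to the body, `3` for the test and `4` for the increment; initialization and
the final failing test add `5`. The hypothesis `hI` makes the invariant insensitive to the counter,
whose value is supplied to `hstep` separately. -/
lemma Runs.forLoop {i m : ℕ} {body : Prog} {s : Store} {M B : ℕ} {I : ℕ → Store → Prop}
    (hm : s.nat m = M) (him : m ≠ i) (hib : i ∉ body.natMods) (hmb : m ∉ body.natMods)
    (hI : ∀ k s' v, I k s' → I k (s'.setNat i v)) (h0 : I 0 s)
    (hstep : ∀ k < M, ∀ s', s'.nat i = k → (∀ v ∉ i :: body.natMods, s'.nat v = s.nat v) →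
      (∀ A ∉ body.realMods, s'.real A = s.real A) → I k s' → Runs body s' B (I (k + 1))) :
    Runs (forLoop i m body) s (M * (B + 7) + 5) (I M) := by
  have main : ∀ d k s', k + d = M → s'.nat i = k → (∀ v ∉ i :: body.natMods, s'.nat v = s.nat v) →
      (∀ A ∉ body.realMods, s'.real A = s.real A) → I k s' →
      Runs (.loop (.natLt (.var i) (.var m)) (.seq body (.setNat i (.add (.var i) (.lit 1)))))
        s' (d * (B + 7) + 3) (I M) := by
    intro d
    induction d with
    | zero =>
      intro k s' hk hi hn hr hIk
      refine ⟨_, _, .loop_false ?_, ?_, ?_⟩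
      · have : s'.nat m = M := by rw [hn m (by simp [him, hmb]), hm]
        simp only [Test.Holds, NExpr.eval, hi, this]; omega
      · simp [Test.cost, NExpr.cost]
      · rw [add_zero] at hk
        exact hk ▸ hIk
    | succ d ih =>
      intro k s' hk hi hn hr hIk
      obtain ⟨t, s₁, he, ht, hI1⟩ := hstep k (by omega) s' hi hn hr hIk
      have fr := he.sameOutside
      have hi1 : s₁.nat i = k := by rw [fr.1 i hib, hi]
      obtain ⟨t', s₂, he', ht', hp⟩ := ih (k + 1) (s₁.setNat i (k + 1)) (by omega) (by simp)
        (fun v hv => by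
          rw [List.mem_cons, not_or] at hv
          rw [setNat_nat_of_ne _ _ hv.1, fr.1 v hv.2, hn v (by simp [hv])])
        (fun A hA => by rw [setNat_real, fr.2 A hA, hr A hA]) (hI _ _ _ hI1)
      have hset : Exec (.setNat i (.add (.var i) (.lit 1))) s₁ 4 (s₁.setNat i (k + 1)) := by
        have := Exec.setNat s₁ i (.add (.var i) (.lit 1))
        simpa [NExpr.eval, NExpr.cost, hi1] using this
      refine ⟨_, _, .loop_true ?_ (.seq he hset) he', ?_, hp⟩
      · have : s'.nat m = M := by rw [hn m (by simp [him, hmb]), hm]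
        simp only [Test.Holds, NExpr.eval, hi, this]; omega
      · simp only [Test.cost, NExpr.cost, Nat.succ_mul]; omega
  refine Runs.seq (B₁ := 2) (Runs.setNat (by simp [NExpr.cost]) (main M 0 _ (by omega) (by simp [NExpr.eval]) ?_
    (fun _ _ => rfl) (hI _ _ _ h0))) (by omega)
  intro v hv
  rw [List.mem_cons, not_or] at hv
  exact setNat_nat_of_ne _ _ hv.1

end RealRAM

namespace RealRAM

/-! ### The program: evaluation of the quadrature sum

Variables: `0`, `1` hold `n`, `r`; `2`, `3`, `4` hold `Q = n * r`, `N = 2 ^ p`, `p`; `5`–`10` are loop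
counters; `11` is a power of two. Arrays: `4`–`7` hold the rates, half widths, levels and weights
of the `Q` factors, `8` the nodes; cell `0` of `9`–`13` holds the bound for the arguments,
the values of `chebIter` and `chebDeriv`, a product and a pole. -/

/-- Cell `0` of an array, used as a real variable. -/
def scalar (A : ℕ) : RExpr := .cell A (.lit 0)

/-- The `q`-th entry of an array, where the counter `q` is a variable. -/
def entry (A q : ℕ) : RExpr := .cell A (.var q)

def rlit (k : ℕ) : RExpr := .ofNat (.lit k)

/-- Doubles the number of nodes: each node `u` is replaced by `±√((1 + u) / 2)`. -/
def splitNodes : Prog :=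
  forLoop 8 11
    (.seq
      (.setReal 8 (.add (.var 11) (.var 8))
        (.sub (rlit 0) (.sqrt (.div (.add (rlit 1) (entry 8 8)) (rlit 2)))))
      (.setReal 8 (.var 8) (.sqrt (.div (.add (rlit 1) (entry 8 8)) (rlit 2)))))

/-- Computes the nodes for the factor with number `var 7`. -/
def nodesProg : Prog :=
  .seq (.setReal 8 (.lit 0) (entry 6 7))
    (.seq (.setNat 11 (.lit 1))
      (forLoop 10 4 (.seq splitNodes (.setNat 11 (.mul (.lit 2) (.var 11))))))

/-- Computes `chebIter` and `chebDeriv`. -/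
def chebProg : Prog :=
  forLoop 10 4
    (.seq (.setReal 11 (.lit 0) (.mul (scalar 11) (.mul (rlit 2) (scalar 10))))
      (.setReal 10 (.lit 0)
        (.sub (.mul (rlit 2) (.mul (scalar 10) (scalar 10))) (rlit 1))))

/-- Multiplies the product by the Laplace transform of the factor with number `var 9`. -/
def factorProg : Prog :=
  .seq (.setReal 10 (.lit 0) (.div (.sub (entry 4 9) (scalar 13)) (entry 5 9)))
    (.seq (.setReal 11 (.lit 0) (rlit 1))
      (.seq chebProg
        (.setReal 12 (.lit 0) (.mul (scalar 12)
          (.div (.mul (entry 7 9) (scalar 11))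
            (.mul (entry 5 9) (.sub (scalar 10) (entry 6 9))))))))

/-- The product over all factors except number `var 7`. -/
def productProg : Prog :=
  forLoop 9 2
    (.ite (.natLt (.lit 0) (.add (.sub (.var 9) (.var 7)) (.sub (.var 7) (.var 9))))
      factorProg .skip)

/-- The contribution of the pole with number `var 8` of the factor with number `var 7`. -/
def poleProg : Prog :=
  .seq (.setReal 13 (.lit 0) (.sub (entry 4 7) (.mul (entry 5 7) (entry 8 8))))
    (.seq (.setReal 12 (.lit 0) (.mul (.div (entry 7 7) (.ofNat (.var 3)))
        (.exp (.sub (rlit 0) (.mul (scalar 13) (scalar 2))))))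
      (.seq productProg (.setReal 3 (.lit 0) (.add (scalar 3) (scalar 12)))))

/-- The sum over all poles. -/
def sumProg : Prog :=
  .seq (.setReal 3 (.lit 0) (rlit 0))
    (forLoop 7 2 (.seq nodesProg (forLoop 8 3 poleProg)))

/-- The pole with number `k` of factor `q`. -/
noncomputable def poleAt (lam del lev : ℕ → ℝ) (p q k : ℕ) : ℝ :=
  lam q - del q * node p (lev q) k

/-- The Laplace transform of the `q`-th factor at the point `-u`. -/
noncomputable def factorAt (lam del lev wt : ℕ → ℝ) (p : ℕ) (u : ℝ) (q : ℕ) : ℝ :=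
  wt q * chebDeriv p ((lam q - u) / del q) /
    (del q * (chebIter p ((lam q - u) / del q) - lev q))

/-- The contribution of pole `k` of factor `q`. -/
noncomputable def poleTerm (lam del lev wt : ℕ → ℝ) (x : ℝ) (Q p q k : ℕ) : ℝ :=
  wt q / (2 ^ p : ℕ) * Real.exp (0 - poleAt lam del lev p q k * x) *
    ∏ q' ∈ Finset.range Q,
      if q' = q then 1 else factorAt lam del lev wt p (poleAt lam del lev p q k) q'

/-- The value that `sumProg` computes. -/
noncomputable def poleSum (lam del lev wt : ℕ → ℝ) (x : ℝ) (Q p : ℕ) : ℝ :=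
  ∑ q ∈ Finset.range Q, ∑ k ∈ Finset.range (2 ^ p), poleTerm lam del lev wt x Q p q k

lemma splitNodes_runs {s : Store} {l : ℕ} {c : ℝ} (hM : s.nat 11 = 2 ^ l)
    (h : ∀ k < 2 ^ l, s.real 8 k = node l c k) :
    Runs splitNodes s (2 ^ l * 40 + 5) fun s' => ∀ k < 2 ^ (l + 1), s'.real 8 k = node (l + 1) c k := by
  -- The doubling is done in place: before round `k` the cells from `k` up to `2^l` still hold old
  -- nodes. Round `k` writes the negative root to cell `2^l + k` first, and only then overwrites the
  -- old node in cell `k`.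
  refine (Runs.forLoop (B := 33) (I := fun k s' =>
    (∀ k' < k, s'.real 8 k' = √((1 + node l c k') / 2) ∧
      s'.real 8 (2 ^ l + k') = -√((1 + node l c k') / 2)) ∧
    ∀ k', k ≤ k' → k' < 2 ^ l → s'.real 8 k' = node l c k') hM (by decide) (by decide) (by decide)
    (fun _ _ _ h => h) ⟨by simp, fun k' _ hk' => h k' hk'⟩ ?_).mono (by omega) ?_
  · intro k hk s' hk8 hn hr ⟨h1, h2⟩
    have h11 : s'.nat 11 = 2 ^ l := by rw [hn 11 (by decide), hM]
    refine (Runs.seq_setReal (Runs.setReal le_rfl ?_)).mono (by decide) fun _ _ h => h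
    have hne : k ≠ 2 ^ l + k := by have : 0 < 2 ^ l := by positivity
                                   omega
    simp only [RExpr.eval, NExpr.eval, entry, rlit, setReal_nat, hk8, h11,
      setReal_real_cell_of_ne _ _ _ hne, h2 k le_rfl hk, Nat.cast_zero, Nat.cast_one, zero_sub,
      Nat.cast_ofNat]
    refine ⟨fun k' hk' => ?_, fun k' hk1 hk2 => ?_⟩
    · rcases Nat.lt_succ_iff_lt_or_eq.1 hk' with h | rfl
      · rw [setReal_real_cell_of_ne _ _ _ (by omega), setReal_real_cell_of_ne _ _ _ (by omega),
          setReal_real_cell_of_ne _ _ _ (by omega), setReal_real_cell_of_ne _ _ _ (by omega)]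
        exact h1 k' h
      · rw [setReal_real_self, setReal_real_cell_of_ne _ _ _ hne.symm, setReal_real_self]
        exact ⟨rfl, rfl⟩
    · rw [setReal_real_cell_of_ne _ _ _ (by omega), setReal_real_cell_of_ne _ _ _ (by omega)]
      exact h2 k' (by omega) hk2
  · intro s' _ ⟨h1, _⟩ k hk
    rcases lt_or_ge k (2 ^ l) with hlt | hge
    · rw [node_succ_of_lt c hlt, (h1 k hlt).1]
    · obtain ⟨j, rfl⟩ := Nat.exists_eq_add_of_le hge
      rw [node_succ_add, (h1 j (by rw [pow_succ] at hk; omega)).2]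

lemma nodesProg_runs {s : Store} {p : ℕ} (hp : s.nat 4 = p) :
    Runs nodesProg s (p * (2 ^ p * 40 + 17) + 13) fun s' =>
      ∀ k < 2 ^ p, s'.real 8 k = node p (s.real 6 (s.nat 7)) k := by
  set c := s.real 6 (s.nat 7)
  refine (Runs.seq_setReal (Runs.seq_setNat (Runs.forLoop (M := p) (B := 2 ^ p * 40 + 10)
    (I := fun l s' => s'.nat 11 = 2 ^ l ∧ ∀ k < 2 ^ l, s'.real 8 k = node l c k)
    (by simpa [setNat_nat_of_ne] using hp) (by decide)
    (by decide) (by decide) (fun k s' v h => ⟨?_, h.2⟩) ⟨by simp [NExpr.eval], ?_⟩ ?_))).mono ?_ ?_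
  · rw [setNat_nat_of_ne _ _ (by decide)]; exact h.1
  · intro k hk
    have : k = 0 := by simpa using hk
    subst this
    simp only [setNat_real, NExpr.eval, setReal_real_self]
    rfl
  · intro l hl s' _ hn hr ⟨h1, h2⟩
    refine Runs.seq ((splitNodes_runs h1 h2).mono le_rfl fun s'' fr h =>
      Runs.setNat (B := 4) (le_refl _) ⟨?_, ?_⟩) ?_
    · simp only [NExpr.eval, setNat_nat_self, fr.1 11 (by decide), h1, pow_succ]; ring
    · exact h
    · have : 2 ^ l ≤ 2 ^ p := Nat.pow_le_pow_right (by norm_num) hl.le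
      omega
  · simp only [RExpr.cost, NExpr.cost, entry]
    ring_nf; omega
  · exact fun s' _ h => h.2

lemma chebProg_runs {s : Store} {p : ℕ} {z : ℝ} (hp : s.nat 4 = p) (hz : s.real 10 0 = z)
    (h1 : s.real 11 0 = 1) :
    Runs chebProg s (p * 33 + 5) fun s' =>
      s'.real 10 0 = chebIter p z ∧ s'.real 11 0 = chebDeriv p z := by
  refine (Runs.forLoop (M := p) (B := 26)
    (I := fun l s' => s'.real 10 0 = chebIter l z ∧ s'.real 11 0 = chebDeriv l z) hp (by decide)
    (by decide) (by decide) (fun k s' v h => h) ⟨hz, by simpa [chebDeriv] using h1⟩ ?_).mono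
    (by omega) fun _ _ h => h
  intro l hl s' _ hn hr ⟨h1, h2⟩
  refine (Runs.seq_setReal (Runs.setReal le_rfl ?_)).mono (by decide) fun _ _ h => h
  simp only [RExpr.eval, NExpr.eval, scalar, rlit, setReal_real_self,
    setReal_real_of_ne _ _ _ (show (10 : ℕ) ≠ 11 by decide),
    setReal_real_of_ne _ _ _ (show (11 : ℕ) ≠ 10 by decide), h1, h2]
  constructor
  · rw [chebIter_succ']; push_cast; ring
  · rw [chebDeriv, chebDeriv, Finset.prod_range_succ]; push_cast; ring

lemma factorProg_runs {s : Store} {p : ℕ} (hp : s.nat 4 = p) :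
    Runs factorProg s (p * 33 + 40) fun s' => s'.real 12 0 = s.real 12 0 *
      factorAt (s.real 4) (s.real 5) (s.real 6) (s.real 7) p (s.real 13 0) (s.nat 9) := by
  refine (Runs.seq_setReal (Runs.seq_setReal (Runs.seq ((chebProg_runs (p := p) (by simpa using hp)
    rfl ?_).mono le_rfl fun s' fr h => Runs.setReal le_rfl ?_) le_rfl))).mono ?_ fun _ _ h => h
  · simp [RExpr.eval, NExpr.eval, rlit]
  · have f4 := fr.2 4 (by decide)
    have f5 := fr.2 5 (by decide)
    have f6 := fr.2 6 (by decide)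
    have f7 := fr.2 7 (by decide)
    have f12 := fr.2 12 (by decide)
    have n9 := fr.1 9 (by decide)
    obtain ⟨h10, h11⟩ := h
    simp only [RExpr.eval, NExpr.eval, scalar, entry, rlit, setReal_real_self, setReal_nat,
      setReal_real_of_ne _ _ _ (show (10 : ℕ) ≠ 11 by decide),
      setReal_real_of_ne _ _ _ (show (4 : ℕ) ≠ 11 by decide),
      setReal_real_of_ne _ _ _ (show (5 : ℕ) ≠ 11 by decide),
      setReal_real_of_ne _ _ _ (show (6 : ℕ) ≠ 11 by decide),
      setReal_real_of_ne _ _ _ (show (7 : ℕ) ≠ 11 by decide),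
      setReal_real_of_ne _ _ _ (show (12 : ℕ) ≠ 11 by decide),
      setReal_real_of_ne _ _ _ (show (4 : ℕ) ≠ 10 by decide),
      setReal_real_of_ne _ _ _ (show (5 : ℕ) ≠ 10 by decide),
      setReal_real_of_ne _ _ _ (show (6 : ℕ) ≠ 10 by decide),
      setReal_real_of_ne _ _ _ (show (7 : ℕ) ≠ 10 by decide),
      setReal_real_of_ne _ _ _ (show (12 : ℕ) ≠ 10 by decide)] at f4 f5 f6 f7 f12 n9 h10 h11 ⊢
    rw [h10, h11, f5, f6, f7, f12, n9]
    rfl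
  · simp only [RExpr.cost, NExpr.cost, entry, scalar, rlit]
    omega

lemma productProg_runs {s : Store} {Q p : ℕ} (hQ : s.nat 2 = Q) (hp : s.nat 4 = p) :
    Runs productProg s (Q * (p * 33 + 56) + 5) fun s' => s'.real 12 0 = s.real 12 0 *
      ∏ q ∈ Finset.range Q, if q = s.nat 7 then 1 else
        factorAt (s.real 4) (s.real 5) (s.real 6) (s.real 7) p (s.real 13 0) q := by
  refine (Runs.forLoop (M := Q) (B := p * 33 + 49) (I := fun m s' => s'.real 12 0 = s.real 12 0 *
      ∏ q ∈ Finset.range m, if q = s.nat 7 then 1 else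
        factorAt (s.real 4) (s.real 5) (s.real 6) (s.real 7) p (s.real 13 0) q) hQ (by decide)
    (by decide) (by decide) (fun k s' v h => h) (by simp) ?_).mono le_rfl fun _ _ h => h
  intro m hm s' h9 hn hr h12
  have h7 := hn 7 (by decide)
  have f4 := hr 4 (by decide)
  have f5 := hr 5 (by decide)
  have f6 := hr 6 (by decide)
  have f7 := hr 7 (by decide)
  have f13 := hr 13 (by decide)
  -- In truncated subtraction, `0 < (q' - q) + (q - q')` says `q' ≠ q`.
  refine Runs.ite (B := p * 33 + 40) (fun h => ?_) (fun h => ?_) (by simp only [Test.cost, NExpr.cost]; omega)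
  · simp only [Test.Holds, NExpr.eval, h7, h9] at h
    refine (factorProg_runs (p := p) (by rw [hn 4 (by decide), hp])).mono le_rfl fun s'' _ h' => ?_
    rw [Finset.prod_range_succ, if_neg (by omega), ← mul_assoc, ← h12, h', f4, f5, f6, f7, f13, h9]
  · simp only [Test.Holds, NExpr.eval, h7, h9] at h
    refine Runs.skip (by omega) ?_
    rw [Finset.prod_range_succ, if_pos (by omega), mul_one, h12]

lemma poleProg_runs {s : Store} {Q p q k : ℕ} (hQ : s.nat 2 = Q) (hN : s.nat 3 = 2 ^ p)
    (hp : s.nat 4 = p) (hq : s.nat 7 = q) (hk : s.nat 8 = k)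
    (hnode : s.real 8 k = node p (s.real 6 q) k) :
    Runs poleProg s (Q * (p * 33 + 56) + 50) fun s' => s'.real 3 0 = s.real 3 0 +
      poleTerm (s.real 4) (s.real 5) (s.real 6) (s.real 7) (s.real 2 0) Q p q k := by
  refine (Runs.seq_setReal (Runs.seq_setReal (Runs.seq ((productProg_runs (Q := Q) (p := p)
    (by simpa using hQ) (by simpa using hp)).mono le_rfl fun s' fr h => Runs.setReal le_rfl ?_)
      le_rfl))).mono ?_ fun _ _ h => h
  · have f3 := fr.2 3 (by decide)
    simp only [RExpr.eval, NExpr.eval, scalar, entry, rlit, setReal_real_self, setReal_nat,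
      setReal_real_of_ne _ _ _ (show (2 : ℕ) ≠ 13 by decide),
      setReal_real_of_ne _ _ _ (show (3 : ℕ) ≠ 13 by decide),
      setReal_real_of_ne _ _ _ (show (4 : ℕ) ≠ 13 by decide),
      setReal_real_of_ne _ _ _ (show (5 : ℕ) ≠ 13 by decide),
      setReal_real_of_ne _ _ _ (show (6 : ℕ) ≠ 13 by decide),
      setReal_real_of_ne _ _ _ (show (7 : ℕ) ≠ 13 by decide),
      setReal_real_of_ne _ _ _ (show (3 : ℕ) ≠ 12 by decide),
      setReal_real_of_ne _ _ _ (show (4 : ℕ) ≠ 12 by decide),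
      setReal_real_of_ne _ _ _ (show (5 : ℕ) ≠ 12 by decide),
      setReal_real_of_ne _ _ _ (show (6 : ℕ) ≠ 12 by decide),
      setReal_real_of_ne _ _ _ (show (7 : ℕ) ≠ 12 by decide),
      setReal_real_of_ne _ _ _ (show (13 : ℕ) ≠ 12 by decide), hq, hk, hnode, hN] at f3 h ⊢
    rw [h, f3, Nat.cast_zero]
    rfl
  · simp only [RExpr.cost, NExpr.cost, entry, scalar, rlit]
    omega

/-- A bound for the cost of `sumProg`. -/
def sumCost (Q p : ℕ) : ℕ :=
  Q * (p * (2 ^ p * 40 + 17) + 13 + (2 ^ p * (Q * (p * 33 + 56) + 57) + 5) + 7) + 10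

lemma sumProg_runs {s : Store} {Q p : ℕ} (hQ : s.nat 2 = Q) (hN : s.nat 3 = 2 ^ p)
    (hp : s.nat 4 = p) :
    Runs sumProg s (sumCost Q p) fun s' => s'.real 3 0 =
      poleSum (s.real 4) (s.real 5) (s.real 6) (s.real 7) (s.real 2 0) Q p := by
  refine (Runs.seq_setReal (Runs.forLoop (M := Q)
    (B := p * (2 ^ p * 40 + 17) + 13 + (2 ^ p * (Q * (p * 33 + 56) + 57) + 5))
    (I := fun m s' => s'.real 3 0 = ∑ q ∈ Finset.range m, ∑ k ∈ Finset.range (2 ^ p),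
      poleTerm (s.real 4) (s.real 5) (s.real 6) (s.real 7) (s.real 2 0) Q p q k)
    (by simpa using hQ) (by decide) (by decide) (by decide) (fun k s' v h => h)
    (by simp [RExpr.eval, NExpr.eval, rlit]) ?_)).mono ?_ fun _ _ h => h
  · intro q _ s₁ h7 hn hr h3
    have e2 := (hr 2 (by decide)).trans (setReal_real_of_ne s _ _ (by decide))
    have e4 := (hr 4 (by decide)).trans (setReal_real_of_ne s _ _ (by decide))
    have e5 := (hr 5 (by decide)).trans (setReal_real_of_ne s _ _ (by decide))
    have e6 := (hr 6 (by decide)).trans (setReal_real_of_ne s _ _ (by decide))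
    have e7 := (hr 7 (by decide)).trans (setReal_real_of_ne s _ _ (by decide))
    have n2 : s₁.nat 2 = Q := (hn 2 (by decide)).trans hQ
    have n3 : s₁.nat 3 = 2 ^ p := (hn 3 (by decide)).trans hN
    have n4 : s₁.nat 4 = p := (hn 4 (by decide)).trans hp
    refine Runs.seq ((nodesProg_runs n4).mono le_rfl fun s₂ fr₂ hnode => ?_) le_rfl
    refine (Runs.forLoop (M := 2 ^ p) (B := Q * (p * 33 + 56) + 50)
      (I := fun m s' => s'.real 3 0 = s₁.real 3 0 + ∑ k ∈ Finset.range m,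
        poleTerm (s.real 4) (s.real 5) (s.real 6) (s.real 7) (s.real 2 0) Q p q k)
      ((fr₂.1 3 (by decide)).trans n3) (by decide) (by decide) (by decide) (fun k s' v h => h)
      (by rw [fr₂.2 3 (by decide)]; simp) ?_).mono le_rfl fun _ _ h => ?_
    · intro k hk s₃ h8 hn₃ hr₃ h3'
      have e2' := ((hr₃ 2 (by decide)).trans (fr₂.2 2 (by decide))).trans e2
      have e4' := ((hr₃ 4 (by decide)).trans (fr₂.2 4 (by decide))).trans e4
      have e5' := ((hr₃ 5 (by decide)).trans (fr₂.2 5 (by decide))).trans e5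
      have e6' := ((hr₃ 6 (by decide)).trans (fr₂.2 6 (by decide))).trans e6
      have e7' := ((hr₃ 7 (by decide)).trans (fr₂.2 7 (by decide))).trans e7
      refine (poleProg_runs (Q := Q) (p := p) (q := q) (k := k)
        (((hn₃ 2 (by decide)).trans (fr₂.1 2 (by decide))).trans n2)
        (((hn₃ 3 (by decide)).trans (fr₂.1 3 (by decide))).trans n3)
        (((hn₃ 4 (by decide)).trans (fr₂.1 4 (by decide))).trans n4)
        (((hn₃ 7 (by decide)).trans (fr₂.1 7 (by decide))).trans h7) h8 ?_).mono le_rfl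
        fun s₄ _ h => ?_
      · rw [hr₃ 8 (by decide), hnode k hk, h7, e6, e6']
      · rw [h, e2', e4', e5', e6', e7', h3', Finset.sum_range_succ, add_assoc]
    · rw [h, h3, Finset.sum_range_succ]
  · simp only [RExpr.cost, NExpr.cost, rlit, sumCost]
    omega

end RealRAM

namespace RealRAM

/-! ### The program: parameters of the factors -/

/-- The midpoint of the interval of rates that belongs to the coefficients `a < b`. -/
noncomputable def rateMid (a b : ℝ) : ℝ := (1 / a + 1 / b) / 4

/-- Half the length of the interval of rates that belongs to the coefficients `a < b`. -/
noncomputable def rateHalf (a b : ℝ) : ℝ := (1 / a - 1 / b) / 4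

noncomputable def pairWeight (a b : ℝ) : ℝ := 1 / (2 * √(a * b))

/-- `x * (b - a) / (4 a b)` for the current pair. -/
def argExpr : RExpr :=
  .mul (scalar 2) (.div (.sub (entry 1 5) (entry 0 5))
    (.mul (.mul (rlit 4) (entry 0 5)) (entry 1 5)))

/-- The number of the current factor. -/
def factorIndex : NExpr := .add (.mul (.var 5) (.var 1)) (.var 6)

/-- Stores the parameters of the current factor. -/
def fillProg : Prog :=
  .seq (.setReal 4 factorIndex
      (.div (.add (.div (rlit 1) (entry 0 5)) (.div (rlit 1) (entry 1 5))) (rlit 4)))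
    (.seq (.setReal 5 factorIndex
        (.div (.sub (.div (rlit 1) (entry 0 5)) (.div (rlit 1) (entry 1 5))) (rlit 4)))
      (.seq (.setReal 6 factorIndex (.div (.ofNat (.var 6)) (.ofNat (.var 1))))
        (.setReal 7 factorIndex
          (.div (rlit 1) (.mul (rlit 2) (.sqrt (.mul (entry 0 5) (entry 1 5))))))))

/-- Updates the bound for the arguments and stores the parameters of all factors of a pair. -/
def pairProg : Prog :=
  .seq (.ite (.realLt (scalar 9) argExpr) (.setReal 9 (.lit 0) argExpr) .skip)
    (forLoop 6 1 fillProg)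

def setupProg : Prog :=
  .seq (.setNat 2 (.mul (.var 0) (.var 1)))
    (.seq (.setReal 9 (.lit 0) (rlit 1)) (forLoop 5 0 pairProg))

/-- The first `m` factors have their parameters in the arrays `4`–`7`. -/
def ParamsStored (A B : ℕ → ℝ) (r m : ℕ) (s : Store) : Prop :=
  ∀ q < m, s.real 4 q = rateMid (A (q / r)) (B (q / r)) ∧
    s.real 5 q = rateHalf (A (q / r)) (B (q / r)) ∧
    s.real 6 q = (q % r : ℕ) / (r : ℝ) ∧ s.real 7 q = pairWeight (A (q / r)) (B (q / r))

lemma fillProg_runs {s : Store} {r j d : ℕ} (hr : s.nat 1 = r) (hj : s.nat 5 = j)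
    (hd : s.nat 6 = d) (hdr : d < r) (h : ParamsStored (s.real 0) (s.real 1) r (j * r + d) s) :
    Runs fillProg s 80 (ParamsStored (s.real 0) (s.real 1) r (j * r + (d + 1))) := by
  have hdiv : (j * r + d) / r = j := by
    rw [mul_comm, Nat.mul_add_div (by omega), Nat.div_eq_of_lt hdr, add_zero]
  have hmod : (j * r + d) % r = d := by
    rw [mul_comm, Nat.mul_add_mod, Nat.mod_eq_of_lt hdr]
  refine (Runs.seq_setReal (Runs.seq_setReal (Runs.seq_setReal (Runs.setReal le_rfl ?_)))).mono
    (by decide) fun _ _ h => h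
  intro q hq
  simp only [RExpr.eval, NExpr.eval, entry, rlit, factorIndex, setReal_nat, hr, hj, hd]
  rcases Nat.lt_succ_iff_lt_or_eq.1 hq with hlt | heq
  · have hne : q ≠ j * r + d := hlt.ne
    have := h q hlt
    simpa [setReal_real_of_ne, setReal_real_cell_of_ne _ _ _ hne] using this
  · obtain rfl : q = j * r + d := heq
    rw [hdiv, hmod]
    simp [setReal_real_of_ne, rateMid, rateHalf, pairWeight]

/-- The stored bound is controlled from both sides: it dominates every argument of the exponential
means, as accuracy requires, and stays below any admissible `W`, as the cost bound requires. -/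
lemma setupProg_runs {s : Store} {n r : ℕ} {W : ℝ} (hn : s.nat 0 = n) (hr : s.nat 1 = r)
    (hW : 1 ≤ W)
    (hle : ∀ j < n, s.real 2 0 * ((s.real 1 j - s.real 0 j) / (4 * s.real 0 j * s.real 1 j)) ≤ W) :
    Runs setupProg s (n * (r * 87 + 60) + 20) fun s' => s'.nat 2 = n * r ∧
      ParamsStored (s.real 0) (s.real 1) r (n * r) s' ∧ 1 ≤ s'.real 9 0 ∧ s'.real 9 0 ≤ W ∧
      ∀ j < n, s.real 2 0 * ((s.real 1 j - s.real 0 j) / (4 * s.real 0 j * s.real 1 j)) ≤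
        s'.real 9 0 := by
  refine (Runs.seq_setNat (Runs.seq_setReal ((Runs.forLoop (M := n) (B := r * 87 + 50)
    (I := fun m s' => ParamsStored (s.real 0) (s.real 1) r (m * r) s' ∧ 1 ≤ s'.real 9 0 ∧
      s'.real 9 0 ≤ W ∧ ∀ j < m,
        s.real 2 0 * ((s.real 1 j - s.real 0 j) / (4 * s.real 0 j * s.real 1 j)) ≤ s'.real 9 0)
    (by simpa [setNat_nat_of_ne] using hn) (by decide) (by decide) (by decide)
    (fun k s' v h => h) ?_ ?_).mono le_rfl fun s' fr h => ⟨?_, h⟩))).mono ?_ fun _ _ h => h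
  · refine ⟨fun q hq => ?_, ?_, ?_, fun j hj => ?_⟩
    · simp at hq
    · simp [RExpr.eval, NExpr.eval, rlit]
    · simpa [RExpr.eval, NExpr.eval, rlit] using hW
    · simp at hj
  · intro j hj s₁ h5 hn₁ hr₁ ⟨h1, h2, h3, h4⟩
    have n1 : s₁.nat 1 = r := by
      rw [hn₁ 1 (by decide)]; simpa [setNat_nat_of_ne] using hr
    have r0 : s₁.real 0 = s.real 0 := by
      rw [hr₁ 0 (by decide)]; simp [setReal_real_of_ne]
    have r1 : s₁.real 1 = s.real 1 := by
      rw [hr₁ 1 (by decide)]; simp [setReal_real_of_ne]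
    have r2 : s₁.real 2 = s.real 2 := by
      rw [hr₁ 2 (by decide)]; simp [setReal_real_of_ne]
    have harg : argExpr.eval s₁ =
        s.real 2 0 * ((s.real 1 j - s.real 0 j) / (4 * s.real 0 j * s.real 1 j)) := by
      simp [argExpr, RExpr.eval, NExpr.eval, scalar, entry, rlit, h5, r0, r1, r2]
    refine Runs.seq (B₁ := 45) (B₂ := r * 87 + 5) (Runs.ite (B := 22) (fun hc => ?_) (fun hc => ?_)
      (by decide)) (by omega)
    · simp only [Test.Holds, harg] at hc
      refine Runs.setReal (by decide) ?_
      refine (Runs.forLoop (M := r) (B := 80)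
        (I := fun m s' => ParamsStored (s.real 0) (s.real 1) r (j * r + m) s')
        (by simpa using n1) (by decide) (by decide) (by decide) (fun k s' v h => h) ?_ ?_).mono
        le_rfl fun s₃ fr h => ⟨?_, ?_⟩
      · intro q hq
        simpa [setReal_real_of_ne] using h1 q hq
      · intro d hd s₂ h6 hn₂ hr₂ hI
        have e0 : s₂.real 0 = s.real 0 := by
          rw [hr₂ 0 (by decide), setReal_real_of_ne _ _ _ (by decide), r0]
        have e1 : s₂.real 1 = s.real 1 := by
          rw [hr₂ 1 (by decide), setReal_real_of_ne _ _ _ (by decide), r1]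
        rw [← e0, ← e1] at hI ⊢
        exact fillProg_runs ((hn₂ 1 (by decide)).trans n1) ((hn₂ 5 (by decide)).trans h5) h6 hd hI
      · rw [Nat.succ_mul]; exact h
      · have e9 : s₃.real 9 0 =
            s.real 2 0 * ((s.real 1 j - s.real 0 j) / (4 * s.real 0 j * s.real 1 j)) := by
          rw [fr.2 9 (by decide), NExpr.eval, setReal_real_self, harg]
        have hs9 : s₁.real 9 0 < s₃.real 9 0 := by
          rw [e9]; simpa [RExpr.eval, NExpr.eval, scalar] using hc
        refine ⟨h2.trans hs9.le, e9 ▸ hle j hj, fun j' hj' => ?_⟩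
        rcases Nat.lt_succ_iff_lt_or_eq.1 hj' with hlt | rfl
        · exact (h4 j' hlt).trans hs9.le
        · exact e9.ge
    · simp only [Test.Holds, harg] at hc
      refine Runs.skip (by omega) ?_
      refine (Runs.forLoop (M := r) (B := 80)
        (I := fun m s' => ParamsStored (s.real 0) (s.real 1) r (j * r + m) s')
        n1 (by decide) (by decide) (by decide) (fun k s' v h => h) h1 ?_).mono
        le_rfl fun s₃ fr h => ⟨?_, ?_⟩
      · intro d hd s₂ h6 hn₂ hr₂ hI
        have e0 : s₂.real 0 = s.real 0 := by rw [hr₂ 0 (by decide), r0]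
        have e1 : s₂.real 1 = s.real 1 := by rw [hr₂ 1 (by decide), r1]
        rw [← e0, ← e1] at hI ⊢
        exact fillProg_runs ((hn₂ 1 (by decide)).trans n1) ((hn₂ 5 (by decide)).trans h5) h6 hd hI
      · rw [Nat.succ_mul]; exact h
      · rw [fr.2 9 (by decide)]
        refine ⟨h2, h3, fun j' hj' => ?_⟩
        rcases Nat.lt_succ_iff_lt_or_eq.1 hj' with hlt | rfl
        · exact h4 j' hlt
        · simpa [RExpr.eval, NExpr.eval, scalar] using hc
  · simp only [RExpr.cost, NExpr.cost, rlit]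
    ring_nf; omega
  · rw [fr.1 2 (by decide)]
    simp [NExpr.eval, hn, hr]

/-! ### The program: the number of nodes -/

/-- Doubles the number of nodes. -/
def doubleProg : Prog :=
  .seq (.setNat 3 (.mul (.lit 2) (.var 3))) (.setNat 4 (.add (.var 4) (.lit 1)))

/-- The body changes only variables `3` and `4`, so the test is a predicate `T` of the level alone,
and the loop stops at the first level `P` where `T` fails. The induction is on the distance `d` to
`P`. -/
lemma loop_doubleProg_runs {c : Test} {T : ℕ → Prop} {s : Store}
    (hT : ∀ s' p, (∀ v, v ≠ 3 → v ≠ 4 → s'.nat v = s.nat v) → s'.real = s.real →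
      s'.nat 3 = 2 ^ p → s'.nat 4 = p → (c.Holds s' ↔ T p)) {P : ℕ} (hP : ¬ T P) :
    ∀ (d p : ℕ) (s' : Store), p + d = P → (∀ i, p ≤ i → i < P → T i) →
      (∀ v, v ≠ 3 → v ≠ 4 → s'.nat v = s.nat v) → s'.real = s.real →
      s'.nat 3 = 2 ^ p → s'.nat 4 = p →
      Runs (.loop c doubleProg) s' (d * (c.cost + 8) + c.cost) fun s'' =>
        s''.nat 3 = 2 ^ P ∧ s''.nat 4 = P
  | 0, p, s', hd, _, hn, hr, h3, h4 => by
    rw [add_zero] at hd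
    subst hd
    exact ⟨_, _, .loop_false fun h => hP ((hT s' p hn hr h3 h4).1 h), by omega, h3, h4⟩
  | d + 1, p, s', hd, hi, hn, hr, h3, h4 => by
    have hb : Runs doubleProg s' 8 fun s₁ => (∀ v, v ≠ 3 → v ≠ 4 → s₁.nat v = s.nat v) ∧
        s₁.real = s.real ∧ s₁.nat 3 = 2 ^ (p + 1) ∧ s₁.nat 4 = p + 1 := by
      refine (Runs.seq_setNat (Runs.setNat le_rfl ⟨fun v hv hv' => ?_, ?_, ?_, ?_⟩)).mono
        (by decide) fun _ _ h => h
      · rw [setNat_nat_of_ne _ _ hv', setNat_nat_of_ne _ _ hv, hn v hv hv']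
      · simpa using hr
      · rw [setNat_nat_of_ne _ _ (by decide), setNat_nat_self, NExpr.eval, NExpr.eval, NExpr.eval,
          h3, pow_succ, mul_comm]
      · rw [setNat_nat_self, NExpr.eval, NExpr.eval, NExpr.eval, setNat_nat_of_ne _ _ (by decide),
          h4]
    obtain ⟨t, s₁, he, ht, g1, g2, g3, g4⟩ := hb
    obtain ⟨t', s₂, he', ht', hp⟩ := loop_doubleProg_runs hT hP d (p + 1) s₁ (by omega)
      (fun i h => hi i (by omega)) g1 g2 g3 g4
    refine ⟨_, _, .loop_true ((hT s' p hn hr h3 h4).2 (hi p le_rfl (by omega))) he he', ?_, hp⟩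
    rw [Nat.succ_mul]; omega

/-- `N ^ 2 < 729 * V ^ 3`, where `V` bounds the arguments. -/
def argTest : Test :=
  .realLt (.ofNat (.mul (.var 3) (.var 3)))
    (.mul (rlit 729) (.mul (scalar 9) (.mul (scalar 9) (scalar 9))))

/-- `N * p < 5 * log (8 * Q / R)`. -/
def precisionTest : Test :=
  .realLt (.ofNat (.mul (.var 3) (.var 4)))
    (.mul (rlit 5) (.log (.div (.mul (rlit 8) (.ofNat (.var 2))) (.cell 2 (.lit 1)))))

def levelProg : Prog :=
  .seq (.setNat 3 (.lit 2)) (.seq (.setNat 4 (.lit 1))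
    (.seq (.loop argTest doubleProg) (.loop precisionTest doubleProg)))

lemma levelProg_runs {s : Store} {V R : ℝ} {Q P₁ P₂ : ℕ} (hV : s.real 9 0 = V)
    (hR : s.real 2 1 = R) (hQ : s.nat 2 = Q) (h1 : 1 ≤ P₁) (h12 : P₁ ≤ P₂)
    (ha : ∀ i, 1 ≤ i → i < P₁ → ((2 : ℝ) ^ i) ^ 2 < 729 * V ^ 3)
    (ha' : ¬ ((2 : ℝ) ^ P₁) ^ 2 < 729 * V ^ 3)
    (hb : ∀ i, P₁ ≤ i → i < P₂ → (2 : ℝ) ^ i * i < 5 * Real.log (8 * Q / R))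
    (hb' : ¬ (2 : ℝ) ^ P₂ * P₂ < 5 * Real.log (8 * Q / R)) :
    Runs levelProg s (P₂ * 60 + 60) fun s' => s'.nat 3 = 2 ^ P₂ ∧ s'.nat 4 = P₂ := by
  refine (Runs.seq_setNat (Runs.seq_setNat (Runs.seq
    ((loop_doubleProg_runs (c := argTest) (s := s) (T := fun p => ((2 : ℝ) ^ p) ^ 2 < 729 * V ^ 3)
      ?_ ha' (P₁ - 1) 1 _ (by omega) ha ?_ ?_ ?_ ?_).mono le_rfl fun s₁ fr h => ?_)
    (B₂ := (P₂ - P₁) * 25 + 17) le_rfl))).mono ?_ fun _ _ h => h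
  · intro s' p hn hr h3 h4
    simp only [argTest, Test.Holds, RExpr.eval, NExpr.eval, rlit, scalar, h3, hr, hV]
    push_cast
    rw [← pow_two]
    ring_nf
  · intro v hv hv'
    rw [setNat_nat_of_ne _ _ hv', setNat_nat_of_ne _ _ hv]
  · rfl
  · simp [setNat_nat_of_ne, NExpr.eval]
  · simp [NExpr.eval]
  · have q2 : s₁.nat 2 = Q := by
      rw [fr.1 2 (by simp [Prog.natMods, doubleProg])]
      simpa [setNat_nat_of_ne] using hQ
    have rr : s₁.real = s.real := by
      ext A : 1
      rw [fr.2 A (by simp [Prog.realMods, doubleProg])]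
      rfl
    refine (loop_doubleProg_runs (c := precisionTest) (s := s₁)
      (T := fun p => (2 : ℝ) ^ p * p < 5 * Real.log (8 * Q / R)) ?_ hb' (P₂ - P₁) P₁ s₁ (by omega)
        hb (fun _ _ _ => rfl) rfl h.1 h.2).mono le_rfl fun _ _ h => h
    intro s' p hn hr h3 h4
    simp only [precisionTest, Test.Holds, RExpr.eval, NExpr.eval, rlit, h3, h4, hr, rr, hR,
      hn 2 (by decide) (by decide), q2]
    push_cast
    rfl
  · simp only [argTest, Test.cost, RExpr.cost, NExpr.cost, rlit, scalar]
    omega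

/-- The complete program. -/
def densityProg : Prog := .seq setupProg (.seq levelProg sumProg)

/-- The two levels at which the tests of `levelProg` fail for the first time exist, and the number
of nodes at the second one is of the order that the complexity bound allows. -/
lemma exists_levels {V R L : ℝ} {Q : ℕ} (hV : 1 ≤ V) (hQ : 0 < Q) (hR : 0 < R) (hR1 : R < 1)
    (hL : L = 1 + Real.log Q - Real.log R) :
    ∃ P₁ P₂ : ℕ, 1 ≤ P₁ ∧ P₁ ≤ P₂ ∧
      (∀ i, 1 ≤ i → i < P₁ → ((2 : ℝ) ^ i) ^ 2 < 729 * V ^ 3) ∧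
      ¬ ((2 : ℝ) ^ P₁) ^ 2 < 729 * V ^ 3 ∧
      (∀ i, P₁ ≤ i → i < P₂ → (2 : ℝ) ^ i * i < 5 * Real.log (8 * Q / R)) ∧
      ¬ (2 : ℝ) ^ P₂ * P₂ < 5 * Real.log (8 * Q / R) ∧
      (2 : ℝ) ^ P₂ * P₂ ≤ 324 * V ^ 2 * L := by
  classical
  have hQ1 : (1 : ℝ) ≤ Q := by exact_mod_cast hQ
  have hlogQ : 0 ≤ Real.log Q := Real.log_nonneg hQ1
  have hlogR : Real.log R < 0 := Real.log_neg hR hR1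
  have hL1 : 1 ≤ L := by linarith
  have hlog : Real.log (8 * Q / R) ≤ 3 * L := by
    rw [Real.log_div (by positivity) hR.ne', Real.log_mul (by norm_num) (by positivity)]
    have : Real.log 8 ≤ 3 := by
      rw [show (8 : ℝ) = 2 ^ 3 by norm_num, Real.log_pow]
      have := Real.log_two_lt_d9
      push_cast; linarith
    linarith
  have hgrow : ∀ i : ℕ, (i : ℝ) < 2 ^ i := fun i => by exact_mod_cast Nat.lt_two_pow_self
  have ex1 : ∃ i : ℕ, 1 ≤ i ∧ ¬ ((2 : ℝ) ^ i) ^ 2 < 729 * V ^ 3 := by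
    obtain ⟨i, hi⟩ := exists_nat_gt (729 * V ^ 3)
    refine ⟨i + 1, by omega, not_lt.2 ?_⟩
    have h1 := hgrow i
    have h2 : (1 : ℝ) ≤ 2 ^ i := one_le_pow₀ (by norm_num)
    have h3 : (2 : ℝ) ^ i ≤ (2 ^ (i + 1)) ^ 2 := by rw [pow_succ (2 : ℝ) i]; nlinarith
    linarith
  set P₁ := Nat.find ex1
  obtain ⟨h1, ha'⟩ := Nat.find_spec ex1
  have ha : ∀ i, 1 ≤ i → i < P₁ → ((2 : ℝ) ^ i) ^ 2 < 729 * V ^ 3 := fun i hi hlt => by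
    by_contra h
    exact Nat.find_min ex1 hlt ⟨hi, h⟩
  have ex2 : ∃ i : ℕ, P₁ ≤ i ∧ ¬ (2 : ℝ) ^ i * i < 5 * Real.log (8 * Q / R) := by
    obtain ⟨i, hi⟩ := exists_nat_gt (5 * Real.log (8 * Q / R))
    refine ⟨i + P₁, by omega, not_lt.2 ?_⟩
    have h2 : (1 : ℝ) ≤ 2 ^ (i + P₁) := one_le_pow₀ (by norm_num)
    have h3 : (i : ℝ) ≤ (i + P₁ : ℕ) := by exact_mod_cast Nat.le_add_right _ _
    nlinarith
  set P₂ := Nat.find ex2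
  obtain ⟨h12, hb'⟩ := Nat.find_spec ex2
  have hb : ∀ i, P₁ ≤ i → i < P₂ → (2 : ℝ) ^ i * i < 5 * Real.log (8 * Q / R) := fun i hi hlt => by
    by_contra h
    exact Nat.find_min ex2 hlt ⟨hi, h⟩
  refine ⟨P₁, P₂, h1, h12, ha, ha', hb, hb', ?_⟩
  have hVL : 1 ≤ V ^ 2 * L := one_le_mul_of_one_le_of_one_le (one_le_pow₀ hV) hL1
  have hVL' : V ^ 2 ≤ V ^ 2 * L := le_mul_of_one_le_right (by positivity) hL1
  have hVL'' : L ≤ V ^ 2 * L := le_mul_of_one_le_left (by linarith) (one_le_pow₀ hV)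
  rcases h12.eq_or_lt with heq | hlt
  · rw [show P₂ = P₁ from heq.symm]
    rcases h1.eq_or_lt with h | h
    · rw [show P₁ = 1 from h.symm]; norm_num; linarith
    · have hT := ha (P₁ - 1) (by omega) (by omega)
      obtain ⟨m, hm⟩ : ∃ m, P₁ = m + 1 := ⟨P₁ - 1, by omega⟩
      rw [hm] at hT ⊢
      rw [Nat.add_sub_cancel] at hT
      -- The test on `V` held at level `m`, so `(2^m)² < 729 V³` and `2^m` is of order `V^(3/2)`.
      -- The spare half power of `V` absorbs the factor `m + 1` through `i³ ≤ 4·2^i`; the constant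
      -- is `64·729² = 324³`.
      have cube : ∀ i : ℕ, (i : ℝ) ^ 3 ≤ 4 * 2 ^ i := by
        intro i
        rcases lt_or_ge i 4 with h | h
        · interval_cases i <;> norm_num
        · induction i, h using Nat.le_induction with
          | base => norm_num
          | succ i hi ih =>
            have h4 : (4 : ℝ) ≤ i := by exact_mod_cast hi
            rw [pow_succ 2 i]; push_cast
            nlinarith [mul_nonneg (sub_nonneg.2 h4) (sub_nonneg.2 h4),
              mul_nonneg (mul_nonneg (sub_nonneg.2 h4) (sub_nonneg.2 h4)) (sub_nonneg.2 h4)]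
      have h3 : ((2 : ℝ) ^ (m + 1) * (m + 1 : ℕ)) ^ 3 ≤ (324 * V ^ 2) ^ 3 := by
        calc ((2 : ℝ) ^ (m + 1) * (m + 1 : ℕ)) ^ 3
            = ((2 : ℝ) ^ (m + 1)) ^ 3 * ((m + 1 : ℕ) : ℝ) ^ 3 := mul_pow _ _ _
          _ ≤ ((2 : ℝ) ^ (m + 1)) ^ 3 * (4 * 2 ^ (m + 1)) := by gcongr; exact cube _
          _ = 64 * (((2 : ℝ) ^ m) ^ 2) ^ 2 := by rw [pow_succ]; ring
          _ ≤ 64 * (729 * V ^ 3) ^ 2 := by gcongr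
          _ = (324 * V ^ 2) ^ 3 := by ring
      have := le_of_pow_le_pow_left₀ three_ne_zero (by positivity) h3
      linarith
  -- The precision test held one level earlier. A step multiplies `2^m m` by at most `4`, so the
  -- bound is `4·5·3L = 60L`.
  · have hT := hb (P₂ - 1) (by omega) (by omega)
    obtain ⟨m, hm⟩ : ∃ m, P₂ = m + 1 := ⟨P₂ - 1, by omega⟩
    have hm1 : (1 : ℝ) ≤ m := by
      have : 1 ≤ m := by omega
      exact_mod_cast this
    rw [hm] at hT ⊢
    rw [Nat.add_sub_cancel] at hT
    have hpos : (0 : ℝ) < 2 ^ m := by positivity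
    have : (2 : ℝ) ^ (m + 1) * (m + 1 : ℕ) ≤ 4 * (2 ^ m * m) := by
      rw [pow_succ]; push_cast; nlinarith
    linarith

end RealRAM

namespace RealRAM

/-! ### The quadrature sum is a convolution of exponential mixtures -/

lemma poleSum_congr {lam del lev wt lam' del' lev' wt' : ℕ → ℝ} {Q : ℕ}
    (h : ∀ q < Q, lam q = lam' q ∧ del q = del' q ∧ lev q = lev' q ∧ wt q = wt' q) (x : ℝ) (p : ℕ) :
    poleSum lam del lev wt x Q p = poleSum lam' del' lev' wt' x Q p := by
  refine Finset.sum_congr rfl fun q hq => Finset.sum_congr rfl fun k _ => ?_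
  obtain ⟨h1, h2, h3, h4⟩ := h q (Finset.mem_range.1 hq)
  have hpole : poleAt lam del lev p q k = poleAt lam' del' lev' p q k := by
    rw [poleAt, poleAt, h1, h2, h3]
  rw [poleTerm, poleTerm, hpole, h4]
  congr 1
  refine Finset.prod_congr rfl fun q' hq' => ?_
  obtain ⟨g1, g2, g3, g4⟩ := h q' (Finset.mem_range.1 hq')
  rw [factorAt, factorAt, g1, g2, g3, g4]

/-- The hypothesis `hsep` serves twice: it makes the rates of different factors distinct, as the
partial fractions need, and it keeps the denominator in `sum_inv_sub_node` nonzero at each foreign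
pole. -/
lemma poleSum_eq_convChain {lam del lev wt : ℕ → ℝ} {m p : ℕ} (hdel : ∀ q ≤ m, 0 < del q)
    (hlev0 : ∀ q, -1 < lev q) (hlev1 : ∀ q, lev q < 1)
    (hsep : ∀ q ≤ m, ∀ q' ≤ m, q ≠ q' → ∀ k,
      chebIter p ((lam q' - poleAt lam del lev p q k) / del q') ≠ lev q') (x : ℝ) :
    poleSum lam del lev wt x (m + 1) p =
      convChain (expMixture (2 ^ p) (fun q => wt q / (2 ^ p : ℕ)) (poleAt lam del lev p)) m x := by
  have hne : ∀ q ≤ m, ∀ q' ≤ m, q ≠ q' → ∀ k < 2 ^ p, ∀ k' < 2 ^ p,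
      poleAt lam del lev p q k ≠ poleAt lam del lev p q' k' := by
    intro q hq q' hq' hqq k _ k' _ h
    refine hsep q hq q' hq' hqq k ?_
    rw [h, poleAt, sub_sub_cancel, mul_div_cancel_left₀ _ (hdel q' hq').ne',
      chebIter_node (hlev0 _) (hlev1 _)]
  rw [convChain_expMixture m hne, Finset.sum_product, poleSum]
  refine Finset.sum_congr rfl fun q hq => Finset.sum_congr rfl fun k _ => ?_
  have hqm : q ≤ m := Nat.lt_succ_iff.1 (Finset.mem_range.1 hq)
  rw [poleTerm, mixtureCoeff, ← Finset.prod_erase (Finset.range (m + 1)) (a := q) (by simp)]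
  have hprod : ∏ q' ∈ (Finset.range (m + 1)).erase q, (if q' = q then 1 else
      factorAt lam del lev wt p (poleAt lam del lev p q k) q') =
      ∏ q' ∈ (Finset.range (m + 1)).erase q, mixtureLaplace (2 ^ p) (fun q => wt q / (2 ^ p : ℕ))
        (poleAt lam del lev p) q' (poleAt lam del lev p q k) := by
    refine Finset.prod_congr rfl fun q' hq' => ?_
    rw [Finset.mem_erase, Finset.mem_range] at hq'
    have hq'm : q' ≤ m := by omega
    rw [if_neg hq'.1]
    have hs := sum_inv_sub_node (hlev0 q') (hlev1 q') p _ (hsep q hqm q' hq'm hq'.1.symm k)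
    set u := poleAt lam del lev p q k
    have hd := (hdel q' hq'm).ne'
    have hN : ((2 : ℝ) ^ p) ≠ 0 := by positivity
    calc factorAt lam del lev wt p u q'
        = wt q' / (2 ^ p * del q') * (2 ^ p * (chebDeriv p ((lam q' - u) / del q') /
            (chebIter p ((lam q' - u) / del q') - lev q'))) := by
          rw [factorAt]
          field_simp
      _ = _ := by
          rw [← hs, Finset.mul_sum, mixtureLaplace]
          refine Finset.sum_congr rfl fun k' _ => ?_
          have e : poleAt lam del lev p q' k' - u =
              del q' * ((lam q' - u) / del q' - node p (lev q') k') := by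
            rw [poleAt, mul_sub, mul_div_cancel₀ _ hd]; ring
          rw [e]
          push_cast
          rw [div_mul_div_comm, div_div, mul_one, mul_assoc]
  rw [hprod, zero_sub, mul_comm (poleAt lam del lev p q k) x, mul_comm x]
  ring

lemma mod_div_mem (q : ℕ) {r : ℕ} (hr : 0 < r) :
    (-1 : ℝ) < (q % r : ℕ) / (r : ℝ) ∧ (q % r : ℕ) / (r : ℝ) < (1 : ℝ) := by
  have hr' : (0 : ℝ) < r := by exact_mod_cast hr
  refine ⟨lt_of_lt_of_le (by norm_num : (-1 : ℝ) < 0) (by positivity), ?_⟩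
  rw [div_lt_one hr']
  exact_mod_cast Nat.mod_lt _ hr

/-- Different factors have different poles. -/
lemma chebIter_ne_of_ordered {A B : ℕ → ℝ} {n r p : ℕ} (hp : 1 ≤ p) (hr : 0 < r)
    (hA : ∀ j < n, 0 < A j) (hAB : ∀ j < n, A j < B j)
    (hord : ∀ i j, i < j → j < n → B i < A j) {q q' : ℕ} (hq : q < n * r) (hq' : q' < n * r)
    (hne : q ≠ q') (k : ℕ) :
    chebIter p ((rateMid (A (q' / r)) (B (q' / r)) -
      poleAt (fun q => rateMid (A (q / r)) (B (q / r))) (fun q => rateHalf (A (q / r)) (B (q / r)))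
        (fun q => (q % r : ℕ) / (r : ℝ)) p q k) / rateHalf (A (q' / r)) (B (q' / r))) ≠
      (q' % r : ℕ) / (r : ℝ) := by
  have hr' : (0 : ℝ) < r := by exact_mod_cast hr
  have hlev := fun q : ℕ => mod_div_mem q hr
  have hjn : q / r < n := Nat.div_lt_of_lt_mul (by rwa [mul_comm])
  have hjn' : q' / r < n := Nat.div_lt_of_lt_mul (by rwa [mul_comm])
  set j := q / r
  set j' := q' / r
  have hmem := node_mem (hlev q).1 (hlev q).2 p k
  set ζ := node p ((q % r : ℕ) / (r : ℝ)) k with hζ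
  have hhalf : ∀ i < n, 0 < rateHalf (A i) (B i) := fun i hi => by
    have := one_div_lt_one_div_of_lt (hA i hi) (hAB i hi)
    unfold rateHalf; linarith
  have hd := hhalf j hjn
  have hd' := hhalf j' hjn'
  simp only [poleAt]
  change chebIter p ((rateMid (A j') (B j') - (rateMid (A j) (B j) - rateHalf (A j) (B j) * ζ)) /
    rateHalf (A j') (B j')) ≠ _
  have hupper : ∀ i, rateMid (A i) (B i) + rateHalf (A i) (B i) = 1 / A i / 2 := fun i => by
    unfold rateMid rateHalf; ring
  have hlower : ∀ i, rateMid (A i) (B i) - rateHalf (A i) (B i) = 1 / B i / 2 := fun i => by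
    unfold rateMid rateHalf; ring
  obtain ⟨p', rfl⟩ : ∃ p', p = p' + 1 := ⟨p - 1, by omega⟩
  -- For different pairs the rate intervals `[1/(2B), 1/(2A)]` are disjoint, so the rescaled pole
  -- lies outside `[-1, 1]` and its iterate exceeds `1`. Within one pair the iterate is the pole's
  -- own level, which differs because `q` and `q'` then have different residues mod `r`.
  rcases lt_trichotomy j j' with h | h | h
  · have h1 := one_div_lt_one_div_of_lt ((hA j hjn).trans (hAB j hjn)) (hord j j' h hjn')
    have hz : (rateMid (A j') (B j') - (rateMid (A j) (B j) - rateHalf (A j) (B j) * ζ)) /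
        rateHalf (A j') (B j') < -1 := by
      rw [div_lt_iff₀ hd']
      nlinarith [hupper j', hlower j]
    exact ((hlev q').2.trans (one_lt_chebIter_succ (lt_abs.2 (Or.inr (by linarith))) p')).ne'
  · rw [← h, sub_sub_cancel, mul_div_cancel_left₀ _ hd.ne', hζ, chebIter_node (hlev q).1 (hlev q).2]
    intro heq
    rw [div_left_inj' hr'.ne', Nat.cast_inj] at heq
    apply hne
    rw [← Nat.div_add_mod q r, ← Nat.div_add_mod q' r, heq]
    change r * j + _ = r * j' + _
    rw [h]
  · have h1 := one_div_lt_one_div_of_lt ((hA j' hjn').trans (hAB j' hjn')) (hord j' j h hjn)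
    have hz : 1 < (rateMid (A j') (B j') - (rateMid (A j) (B j) - rateHalf (A j) (B j) * ζ)) /
        rateHalf (A j') (B j') := by
      rw [lt_div_iff₀ hd']
      nlinarith [hupper j, hlower j']
    exact ((hlev q').2.trans (one_lt_chebIter_succ (lt_abs.2 (Or.inl hz)) p')).ne'

lemma expMixture_eq_nodeMean (lam del lev wt : ℕ → ℝ) (p q : ℕ) (t : ℝ) :
    expMixture (2 ^ p) (fun q => wt q / (2 ^ p : ℕ)) (poleAt lam del lev p) q t =
      wt q * Real.exp (-(lam q * t)) * nodeMean p (lev q) (fun x => Real.exp (del q * t * x)) := by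
  rw [expMixture, nodeMean, mul_div_assoc', Finset.mul_sum, Finset.sum_div]
  refine Finset.sum_congr rfl fun k _ => ?_
  have : Real.exp (-(poleAt lam del lev p q k * t)) =
      Real.exp (-(lam q * t)) * Real.exp (del q * t * node p (lev q) k) := by
    rw [← Real.exp_add, poleAt]; congr 1; ring
  rw [this]; push_cast; ring

lemma pairDensity_eq (a b t : ℝ) : pairDensity a b t =
    pairWeight a b * Real.exp (-(rateMid a b * t)) *
      arcMean (fun x => Real.exp (rateHalf a b * t * x)) := rfl

lemma rateHalf_eq {a b : ℝ} (ha : 0 < a) (hb : 0 < b) : rateHalf a b = (b - a) / (4 * a * b) := by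
  unfold rateHalf; field_simp

/-- The accuracy of the quadrature sum, given the outcome of the tests for the number of nodes. -/
lemma abs_poleSum_sub_lt {A B : ℕ → ℝ} {n r p : ℕ} {x R V : ℝ} (hn : 0 < n) (hr : 0 < r)
    (hp : 1 ≤ p) (hA : ∀ j, 0 < A j) (hAB : ∀ j, A j < B j)
    (hord : ∀ i j, i < j → j < n → B i < A j) (hx : 0 < x) (hR : 0 < R) (hR1 : R < 1)
    (hV1 : 1 ≤ V) (hV : ∀ j < n, x * ((B j - A j) / (4 * A j * B j)) ≤ V)
    (h1 : ¬ ((2 : ℝ) ^ p) ^ 2 < 729 * V ^ 3)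
    (h2 : ¬ (2 : ℝ) ^ p * p < 5 * Real.log (8 * (n * r : ℕ) / R)) :
    |poleSum (fun q => rateMid (A (q / r)) (B (q / r))) (fun q => rateHalf (A (q / r)) (B (q / r)))
        (fun q => (q % r : ℕ) / (r : ℝ)) (fun q => pairWeight (A (q / r)) (B (q / r))) x (n * r) p -
      convChain (fun q => pairDensity (A (q / r)) (B (q / r))) (n * r - 1) x| <
      R * convChain (fun q => pairDensity (A (q / r)) (B (q / r))) (n * r - 1) x := by
  have hB : ∀ j, 0 < B j := fun j => (hA j).trans (hAB j)
  have hr' : (0 : ℝ) < r := by exact_mod_cast hr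
  obtain ⟨m, hm⟩ : ∃ m, n * r = m + 1 := ⟨n * r - 1, by have := Nat.mul_pos hn hr; omega⟩
  have hlev := fun q : ℕ => mod_div_mem q hr
  have hhalf : ∀ i, 0 < rateHalf (A i) (B i) := fun i => by
    have := one_div_lt_one_div_of_lt (hA i) (hAB i)
    unfold rateHalf; linarith
  have hsum := poleSum_eq_convChain (lam := fun q => rateMid (A (q / r)) (B (q / r)))
    (del := fun q => rateHalf (A (q / r)) (B (q / r))) (lev := fun q => (q % r : ℕ) / (r : ℝ))
    (wt := fun q => pairWeight (A (q / r)) (B (q / r))) (m := m) (p := p) (fun q _ => hhalf _)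
    (fun q => (hlev q).1) (fun q => (hlev q).2)
    (fun q hq q' hq' hne k => chebIter_ne_of_ordered hp hr (fun j _ => hA j) (fun j _ => hAB j) hord
      (by omega) (by omega) hne k) x
  rw [hm, hsum, Nat.add_sub_cancel]
  -- With `Q = m + 1` factors, `(1 + ε)^Q ≤ exp(R/4) ≤ 1 + R/2`, which leaves room for the strict
  -- inequality.
  set ε : ℝ := R / (4 * (m + 1 : ℕ))
  have hε : 0 < ε := by positivity
  have hm1 : (1 : ℝ) ≤ (m + 1 : ℕ) := by push_cast; linarith [Nat.cast_nonneg (α := ℝ) m]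
  have hε1 : ε ≤ 1 := by
    rw [div_le_one (by positivity)]; linarith
  -- Here `8Q/R = 2/ε`. The failed precision test gives `N p ≥ 5 log(2/ε)`, and `5 log 2 ≥ 3` turns
  -- this into `N log N ≥ 3 log(2/ε)`, the logarithm of the claim.
  have hacc : 8 ≤ ε ^ 3 * ((2 ^ p : ℕ) : ℝ) ^ (2 ^ p) := by
    rw [hm] at h2
    have hlog : Real.log 8 - 3 * Real.log ε ≤ (2 ^ p : ℕ) * (p * Real.log 2) := by
      have e1 : Real.log (8 * (m + 1 : ℕ) / R) = Real.log 2 - Real.log ε := by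
        rw [← Real.log_div (by norm_num) hε.ne']
        congr 1
        simp only [ε]
        field_simp
        norm_num
      have e2 : Real.log 8 = 3 * Real.log 2 := by
        rw [show (8 : ℝ) = 2 ^ 3 by norm_num, Real.log_pow]; norm_num
      rw [e1, not_lt] at h2
      have hl := Real.log_two_gt_d9
      have hpos : 0 ≤ (2 : ℝ) ^ p * p := by positivity
      rw [e2]; push_cast
      nlinarith
    rw [← Real.log_le_log_iff (by norm_num) (by positivity), Real.log_mul (by positivity)
      (by positivity), Real.log_pow, Real.log_pow]
    push_cast at hlog ⊢
    rw [Real.log_pow]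
    linarith
  set g := expMixture (2 ^ p) (fun q => pairWeight (A (q / r)) (B (q / r)) / (2 ^ p : ℕ))
    (poleAt (fun q => rateMid (A (q / r)) (B (q / r))) (fun q => rateHalf (A (q / r)) (B (q / r)))
        (fun q => (q % r : ℕ) / (r : ℝ)) p)
  have hgc : ∀ q, Continuous (g q) := fun q => by
    change Continuous fun t => expMixture _ _ _ q t
    unfold expMixture
    fun_prop
  have hgh : ∀ q ≤ m, ∀ t, 0 ≤ t → t ≤ x →
      |g q t - pairDensity (A (q / r)) (B (q / r)) t| ≤ ε * pairDensity (A (q / r)) (B (q / r)) t := by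
    intro q hq t ht htx
    have hd := hhalf (q / r)
    have hy : 0 ≤ rateHalf (A (q / r)) (B (q / r)) * t := by positivity
    have hyV : rateHalf (A (q / r)) (B (q / r)) * t ≤ V := by
      refine le_trans ?_ (hV (q / r) (Nat.div_lt_of_lt_mul (by rw [mul_comm]; omega)))
      rw [← rateHalf_eq (hA _) (hB _), mul_comm]
      gcongr
    have b1 := abs_nodeMean_exp_sub_arcMean_le (hlev q).1 (hlev q).2 hy p
    have b2 := two_mul_pow_div_factorial_mul_exp_le hy hyV hV1 hε (N := 2 ^ p) (by positivity)
      (by push_cast; exact not_lt.1 h1) hacc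
    have b3 := one_le_arcMean_exp (rateHalf (A (q / r)) (B (q / r)) * t)
    rw [show g q t = _ from expMixture_eq_nodeMean _ _ _ _ p q t, pairDensity_eq, ← mul_sub, abs_mul]
    have hw : 0 ≤ pairWeight (A (q / r)) (B (q / r)) *
        Real.exp (-(rateMid (A (q / r)) (B (q / r)) * t)) := by
      unfold pairWeight; positivity
    rw [abs_of_nonneg hw, mul_left_comm]
    refine mul_le_mul_of_nonneg_left ?_ hw
    refine (b1.trans b2).trans ?_
    -- The arcsine mean is at least `1`, so the absolute error `ε` is also a relative one.
    exact le_mul_of_one_le_right hε.le b3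
  have key := abs_convChain_sub_le hgc (fun q => continuous_pairDensity (A (q / r)) (B (q / r))) hε.le
    hε1 (m := m) (x := x) (fun q _ t _ _ => (pairDensity_pos (hA _) (hB _) t).le) hgh hx.le
  refine key.trans_lt ?_
  refine mul_lt_mul_of_pos_right ?_ (convChain_pos (fun q => continuous_pairDensity _ _)
    (fun q t _ => pairDensity_pos (hA _) (hB _) t) m x hx)
  have e1 : (1 + ε) ^ (m + 1) ≤ Real.exp (R / 4) := by
    calc (1 + ε) ^ (m + 1) ≤ Real.exp ε ^ (m + 1) := by
          gcongr; rw [add_comm]; exact Real.add_one_le_exp ε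
      _ = Real.exp (R / 4) := by
          rw [← Real.exp_nat_mul]; congr 1; simp only [ε]; field_simp
  have e2 := Real.abs_exp_sub_one_le (x := R / 4) (by rw [abs_of_pos (by positivity)]; linarith)
  rw [abs_of_pos (a := R / 4) (by positivity)] at e2
  have := (abs_le.1 e2).2
  linarith

/-! ### Assembly: the density, the total cost and one run of the program -/

lemma isPosDensity_indicator {F : ℝ → ℝ} (hF : Continuous F) (hF0 : ∀ t, 0 ≤ t → 0 ≤ F t) :
    IsPosDensity ((Set.Ici 0).indicator F) (halfDensity F) where
  measurable := measurable_indicator_Ici hF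
  nonneg z := Set.indicator_nonneg (fun t ht => hF0 t ht) z
  eq_zero_of_neg z hz := Set.indicator_of_notMem (by simpa using hz) _
  continuousOn := hF.continuousOn.congr fun z hz =>
    Set.indicator_of_mem (s := Set.Ici 0) (le_of_lt hz : (0 : ℝ) ≤ z) F
  law_eq := rfl

/-- The cost of the whole program is of the order `(n r) ^ 2 N p`. -/
lemma total_cost_le {n r p : ℕ} (hn : 0 < n) (hr : 0 < r) (hp : 0 < p) :
    (n * (r * 87 + 60) + 20) + ((p * 60 + 60) + sumCost (n * r) p) ≤
      1000 * ((n * r) ^ 2 * (2 ^ p * p)) := by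
  have hN : 1 ≤ 2 ^ p := Nat.one_le_two_pow
  obtain ⟨N, hNdef⟩ : ∃ N, N = 2 ^ p := ⟨_, rfl⟩
  have hQ : 1 ≤ n * r := Nat.mul_pos hn hr
  have hnQ : n ≤ n * r := Nat.le_mul_of_pos_right n hr
  obtain ⟨Q, hQdef⟩ : ∃ Q, Q = n * r := ⟨_, rfl⟩
  unfold sumCost
  rw [← hNdef] at hN ⊢
  have e : n * (r * 87 + 60) = 87 * (n * r) + 60 * n := by ring
  rw [e]
  rw [← hQdef] at hQ hnQ ⊢
  have hQ2 : Q ≤ Q ^ 2 := Nat.le_self_pow two_ne_zero Q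
  have hM : 1 ≤ N * p := Nat.mul_pos hN hp
  have hpM : p ≤ N * p := Nat.le_mul_of_pos_left p hN
  have hNM : N ≤ N * p := Nat.le_mul_of_pos_right N hp
  -- Every monomial of the cost is at most `Q² N p`, and the coefficients add up to less than
  -- `1000`.
  have a1 : Q ≤ Q ^ 2 * (N * p) := hQ2.trans (Nat.le_mul_of_pos_right _ hM)
  have a2 : Q * p ≤ Q ^ 2 * (N * p) := Nat.mul_le_mul hQ2 hpM
  have a3 : Q * N ≤ Q ^ 2 * (N * p) := Nat.mul_le_mul hQ2 hNM
  have a4 : Q * (N * p) ≤ Q ^ 2 * (N * p) := Nat.mul_le_mul hQ2 le_rfl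
  have a5 : Q ^ 2 * N ≤ Q ^ 2 * (N * p) := Nat.mul_le_mul le_rfl hNM
  have a6 : p ≤ Q * p := Nat.le_mul_of_pos_left p hQ
  have hexp : Q * (p * (N * 40 + 17) + 13 + (N * (Q * (p * 33 + 56) + 57) + 5) + 7) =
      40 * (Q * (N * p)) + 17 * (Q * p) + 25 * Q + 33 * (Q ^ 2 * (N * p)) + 56 * (Q ^ 2 * N) +
        57 * (Q * N) := by ring
  rw [hexp]
  omega

end RealRAM

open RealRAM in
/-- One run of the program: accuracy and cost. -/
lemma RealRAM.densityProg_runs {n r : ℕ} {a b : Fin n → ℝ} {A B : ℕ → ℝ} (hn : 0 < n) (hr : 0 < r)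
    (hAa : ∀ i : Fin n, A i = a i) (hBb : ∀ i : Fin n, B i = b i) (hA : ∀ j, 0 < A j)
    (hAB : ∀ j, A j < B j) (hord : ∀ i j, i < j → j < n → B i < A j) {x R : ℝ} (hx : 0 < x)
    (hR : 0 < R) (hR1 : R < 1) :
    ∃ (t : ℕ) (s : Store), Exec densityProg (inputStore r a b x R) t s ∧
      |s.output - convChain (fun q => pairDensity (A (q / r)) (B (q / r))) (n * r - 1) x| <
        R * convChain (fun q => pairDensity (A (q / r)) (B (q / r))) (n * r - 1) x ∧
      (t : ℝ) ≤ 324000 * (n : ℝ) ^ 2 * (r : ℝ) ^ 2 * (max 1 (yBar a b x)) ^ 2 *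
        (1 + Real.log ((r : ℝ) * n) - Real.log R) := by
  set s₀ := inputStore r a b x R with hs₀
  have n0 : s₀.nat 0 = n := rfl
  have n1 : s₀.nat 1 = r := rfl
  have r2 : s₀.real 2 0 = x := by simp [hs₀, inputStore]
  have r21 : s₀.real 2 1 = R := by simp [hs₀, inputStore]
  have r0 : ∀ j < n, s₀.real 0 j = A j := fun j hj => by
    have := hAa ⟨j, hj⟩
    simp [hs₀, inputStore, toArray, hj, this]
  have r1 : ∀ j < n, s₀.real 1 j = B j := fun j hj => by
    have := hBb ⟨j, hj⟩
    simp [hs₀, inputStore, toArray, hj, this]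
  have hyBar : ∀ j < n, x * ((B j - A j) / (4 * A j * B j)) ≤ yBar a b x := fun j hj => by
    unfold yBar
    refine mul_le_mul_of_nonneg_left ?_ hx.le
    rw [show A j = a ⟨j, hj⟩ from hAa ⟨j, hj⟩, show B j = b ⟨j, hj⟩ from hBb ⟨j, hj⟩]
    exact le_ciSup (f := fun i => (b i - a i) / (4 * a i * b i)) (Set.finite_range _).bddAbove
      (⟨j, hj⟩ : Fin n)
  obtain ⟨t₁, s₁, he₁, ht₁, h2, hpar, hV1, hVW, hVle⟩ := setupProg_runs (s := s₀)
    (W := max 1 (yBar a b x)) n0 n1 (le_max_left _ _) (fun j hj => by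
      rw [r0 j hj, r1 j hj, r2]; exact (hyBar j hj).trans (le_max_right _ _))
  have fr₁ := he₁.sameOutside
  set V := s₁.real 9 0
  have hQ : 0 < n * r := Nat.mul_pos hn hr
  obtain ⟨P₁, P₂, p1, p12, ha, ha', hb, hb', hcost⟩ := exists_levels hV1 hQ hR hR1 rfl
  obtain ⟨t₂, s₂, he₂, ht₂, h3, h4⟩ := levelProg_runs (s := s₁) (V := V) (R := R) (Q := n * r) rfl
    ((congrFun (fr₁.2 2 (by decide)) 1).trans r21) h2 p1 p12 ha ha' hb hb'
  have fr₂ := he₂.sameOutside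
  obtain ⟨t₃, s₃, he₃, ht₃, hout⟩ := sumProg_runs (s := s₂) (Q := n * r) (p := P₂)
    ((fr₂.1 2 (by decide)).trans h2) h3 h4
  refine ⟨_, _, .seq he₁ (.seq he₂ he₃), ?_, ?_⟩
  · have hval : s₃.output = poleSum (fun q => rateMid (A (q / r)) (B (q / r)))
        (fun q => rateHalf (A (q / r)) (B (q / r))) (fun q => (q % r : ℕ) / (r : ℝ))
        (fun q => pairWeight (A (q / r)) (B (q / r))) x (n * r) P₂ := by
      have e2 : s₂.real 2 0 = x := by
        rw [fr₂.2 2 (by decide), fr₁.2 2 (by decide), r2]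
      rw [Store.output, hout, e2]
      refine poleSum_congr (fun q hq => ?_) x P₂
      have hj : q / r < n := Nat.div_lt_of_lt_mul (by rwa [mul_comm])
      have := hpar q hq
      rw [r0 _ hj, r1 _ hj] at this
      rwa [fr₂.2 4 (by decide), fr₂.2 5 (by decide), fr₂.2 6 (by decide), fr₂.2 7 (by decide)]
    rw [hval]
    refine abs_poleSum_sub_lt hn hr (p1.trans p12) hA hAB hord hx hR hR1 hV1 (fun j hj => ?_) ?_ hb'
    · have := hVle j hj
      rwa [r0 j hj, r1 j hj, r2] at this
    -- The test on `V` failed at level `P₁`; it also fails at `P₂ ≥ P₁`, since `N` has only grown.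
    · rw [not_lt] at ha' ⊢
      refine ha'.trans ?_
      have : (2 : ℝ) ^ P₁ ≤ 2 ^ P₂ := pow_le_pow_right₀ (by norm_num) p12
      gcongr
  · have ht : t₁ + (t₂ + t₃) ≤ 1000 * ((n * r) ^ 2 * (2 ^ P₂ * P₂)) :=
      (by omega : _ ≤ _).trans (total_cost_le hn hr (by omega : 0 < P₂))
    have hlog : Real.log ((n * r : ℕ) : ℝ) = Real.log ((r : ℝ) * n) := by
      push_cast; rw [mul_comm]
    rw [hlog] at hcost
    have hL : 0 ≤ 1 + Real.log ((r : ℝ) * n) - Real.log R := by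
      have := Real.log_neg hR hR1
      have : 0 ≤ Real.log ((r : ℝ) * n) := by
        rw [← hlog]; exact Real.log_nonneg (by exact_mod_cast hQ)
      linarith
    calc ((t₁ + (t₂ + t₃) : ℕ) : ℝ) ≤ (1000 * ((n * r) ^ 2 * (2 ^ P₂ * P₂)) : ℕ) := by
          exact_mod_cast ht
      _ = 1000 * ((n : ℝ) ^ 2 * (r : ℝ) ^ 2) * ((2 : ℝ) ^ P₂ * P₂) := by push_cast; ring
      _ ≤ 1000 * ((n : ℝ) ^ 2 * (r : ℝ) ^ 2) * (324 * V ^ 2 *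
            (1 + Real.log ((r : ℝ) * n) - Real.log R)) := by gcongr
      _ ≤ 1000 * ((n : ℝ) ^ 2 * (r : ℝ) ^ 2) * (324 * (max 1 (yBar a b x)) ^ 2 *
            (1 + Real.log ((r : ℝ) * n) - Real.log R)) := by gcongr
      _ = _ := by ring

theorem theorem2 :
    ∃ (P : RealRAM.Prog) (C : ℝ), 0 < C ∧
      ∀ (n r : ℕ), 0 < n → Odd r →
      ∀ (a b : Fin n → ℝ), (∀ i, 0 < a i) → (∀ i, a i < b i) → (∀ i j, i < j → b i < a j) →
      ∀ (Ω : Type*) (_ : MeasurableSpace Ω) (μ : Measure Ω) (_ : IsProbabilityMeasure μ)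
        (X Y : Fin n → Ω → ℝ),
        (∀ i, HasLaw (X i) (chiSq r) μ) → (∀ i, HasLaw (Y i) (chiSq r) μ) →
        iIndepFun (Sum.elim X Y) μ →
      ∃ f : ℝ → ℝ,
        IsPosDensity f (μ.map (fun ω => ∑ i, (a i * X i ω + b i * Y i ω))) ∧
        ∀ x R : ℝ, 0 < x → 0 < R → R < 1 →
          ∃ (t : ℕ) (s : RealRAM.Store),
            RealRAM.Exec P (RealRAM.inputStore r a b x R) t s ∧
            |s.output - f x| < R * f x ∧
            (t : ℝ) ≤ C * (n : ℝ) ^ 2 * (r : ℝ) ^ 2 * (max 1 (yBar a b x)) ^ 2 *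
              (1 + Real.log ((r : ℝ) * n) - Real.log R) := by
  refine ⟨RealRAM.densityProg, 324000, by norm_num, ?_⟩
  intro n r hn hodd a b ha hab hord Ω _ μ _ X Y hX hY hind
  have hr : 0 < r := hodd.pos
  -- The values `1 < 2` beyond `n` keep positivity and `A j < B j` valid for all indices, so that
  -- every factor of the infinite family is a genuine pair density.
  set A : ℕ → ℝ := fun j => if h : j < n then a ⟨j, h⟩ else 1
  set B : ℕ → ℝ := fun j => if h : j < n then b ⟨j, h⟩ else 2
  have hAa : ∀ i : Fin n, A i = a i := fun i => by simp [A]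
  have hBb : ∀ i : Fin n, B i = b i := fun i => by simp [B]
  have hA : ∀ j, 0 < A j := fun j => by
    by_cases h : j < n <;> simp [A, h, ha]
  have hAB : ∀ j, A j < B j := fun j => by
    by_cases h : j < n <;> simp [A, B, h, hab]
  have hAB' : ∀ i j, i < j → j < n → B i < A j := fun i j hij hj => by
    have hi : i < n := hij.trans hj
    simpa [A, B, hi, hj] using hord ⟨i, hi⟩ ⟨j, hj⟩ hij
  have hB : ∀ j, 0 < B j := fun j => (hA j).trans (hAB j)
  set F := convChain (fun q => pairDensity (A (q / r)) (B (q / r))) (n * r - 1)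
  refine ⟨(Set.Ici 0).indicator F, ?_, fun x R hx hR hR1 => ?_⟩
  · rw [map_sum_eq_halfDensity hn hr hAa hBb hA hB hX hY hind]
    exact RealRAM.isPosDensity_indicator
      (continuous_convChain (fun q => continuous_pairDensity _ _) _)
      (convChain_nonneg (fun q t _ => (pairDensity_pos (hA _) (hB _) t).le) _)
  · rw [Set.indicator_of_mem (show x ∈ Set.Ici 0 from hx.le)]
    exact RealRAM.densityProg_runs hn hr hAa hBb hA hAB hAB' hx hR hR1
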